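/- For real parameters $c\ge 0$, $0\le\alpha\le 1$, $\Lambda>0$ let $$X^E_{c}=X^E_{c,\alpha,\Lambda}=y\,\frac{\partial}{\partial x}+\frac1\Lambda\bigl(cy+\operatorname{sign}(x)|x|^{\alpha}\bigr)\frac{\partial}{\partial y}\qquad\text{on }\mathbb R^2,$$ where $\operatorname{sign}(0)=0$ and $\operatorname{sign}(x)=\pm1$ otherwise (so that $\operatorname{sign}(x)|x|^0=\operatorname{sign}(x)$ when $\alpha=0$). An orbit of a vector field $X$ on $\mathbb R^2$ is either a singular point of $X$, or the image, oriented by time, of a trajectory of $X$ that avoids the singular points and is maximal (on an open time interval) among such trajectories; here a trajectory is a continuous curve $\gamma$ with $\gamma(t)-\gamma(s)=\int_s^tX(\gamma(u))\,du$ for all times $s,t$ of its interval, i.e. a classical solution of $\gamma'=X(\gamma)$ if $X$ is continuous. Two vector fields $X,Y$ on $\mathbb R^2$ are topologically equivalent if some homeomorphism of $\mathbb R^2$ sends the orbits of $X$ onto the orbits of $Y$, preserving the time orientation, so that every orbit of $Y$ is the image of an orbit of $X$. This is an equivalence relation, and the class of $X$ is called its phase portrait. (i) For all $c\ge0$, $0\le\alpha\le1$,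 $\Lambda>0$, the field $X^E_{c,\alpha,\Lambda}$ is topologically equivalent on $\mathbb R^2$ to the linear saddle $X_0=y\,\frac{\partial}{\partial x}+x\,\frac{\partial}{\partial y}$, which is $X^E_{c,\alpha,\Lambda}$ for $c=0$, $\alpha=1$, $\Lambda=1$. (ii) Hence the phase portrait of $X^E_{c,\alpha,\Lambda}$ does not depend on $c\ge0$, $\alpha\in[0,1]$ or $\Lambda>0$. (iii) This holds although, for $0\le\alpha<1$, the field $X^E_{c,\alpha,\Lambda}$ is not of class $C^1$ and the origin is not a hyperbolic singularity of it (a hyperbolic singularity is a zero of the field at which the field is differentiable and its derivative has no eigenvalue with zero real part). -/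

import Mathlib

namespace PhasePortrait

open Set MeasureTheory

/-- The manifold ℝ² on which all vector fields live; a vector field is a map to itself. -/
abbrev Plane : Type := ℝ × ℝ

/-- `γ`, restricted to the nonempty open interval `I`, is a trajectory of the vector field `X`
through regular (non-singular) points: it is continuous, does not meet the zeros of `X`, and
satisfies `γ' = X ∘ γ` in integrated form. If `X` is continuous this is the classical notion of
a solution; the integrated form also makes sense for fields that are only piecewise continuous. -/
structure IsRegularTrajectory (X : Plane → Plane) (I : Set ℝ) (γ : ℝ → Plane) : Prop where
  isOpen : IsOpen I
  ordConnected : I.OrdConnected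
  nonempty : I.Nonempty
  continuousOn : ContinuousOn γ I
  regular : ∀ t ∈ I, X (γ t) ≠ 0
  integrable : ∀ s ∈ I, ∀ t ∈ I, IntervalIntegrable (fun u => X (γ u)) volume s t
  integral_eq : ∀ s ∈ I, ∀ t ∈ I, γ t - γ s = ∫ u in s..t, X (γ u)

/-- A regular trajectory whose interval of definition cannot be enlarged among the regular
trajectories. (A trajectory that tends to a singular point in finite time ends there.) -/
def IsMaximalRegularTrajectory (X : Plane → Plane) (I : Set ℝ) (γ : ℝ → Plane) : Prop :=
  IsRegularTrajectory X I γ ∧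
    ∀ (J : Set ℝ) (δ : ℝ → Plane), IsRegularTrajectory X J δ → I ⊆ J → EqOn γ δ I → J = I

/-- `γ` on `I` parametrizes an orbit of `X` in the direction of increasing time: either the orbit
is one singular point, or it is the image of a maximal trajectory through regular points. For a
locally Lipschitz field these are the usual orbits. -/
def ParametrizesOrbit (X : Plane → Plane) (I : Set ℝ) (γ : ℝ → Plane) : Prop :=
  (I = univ ∧ ∃ p, X p = 0 ∧ ∀ t, γ t = p) ∨ IsMaximalRegularTrajectory X I γ

/-- The bijection `H` sends every orbit of `X` onto an orbit of `Y` and preserves the time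
orientation: along each orbit it is an increasing change of the time parameter. -/
def MapsOrbits (H : Plane → Plane) (X Y : Plane → Plane) : Prop :=
  ∀ (I : Set ℝ) (γ : ℝ → Plane), ParametrizesOrbit X I γ →
    ∃ (J : Set ℝ) (δ : ℝ → Plane) (τ : ℝ → ℝ), ParametrizesOrbit Y J δ ∧
      StrictMonoOn τ I ∧ τ '' I = J ∧ ∀ t ∈ I, H (γ t) = δ (τ t)

/-- Topological equivalence of vector fields: some homeomorphism sends the oriented orbits of `X`
onto those of `Y`, and each oriented orbit of `Y` is obtained in this way. -/
def TopologicallyEquivalent (X Y : Plane → Plane) : Prop :=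
  ∃ H : Plane ≃ₜ Plane, MapsOrbits H X Y ∧ MapsOrbits H.symm Y X

theorem MapsOrbits.refl (X : Plane → Plane) : MapsOrbits (fun p => p) X X := fun I γ h =>
  ⟨I, γ, fun t => t, h, fun _ _ _ _ hab => hab, by simp, fun _ _ => rfl⟩

theorem MapsOrbits.comp {G H : Plane → Plane} {X Y Z : Plane → Plane} (hG : MapsOrbits G Y Z)
    (hH : MapsOrbits H X Y) : MapsOrbits (fun p => G (H p)) X Z := by
  intro I γ h
  obtain ⟨J, δ, τ, hδ, hτ, himg, heq⟩ := hH I γ h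
  obtain ⟨K, ε, σ, hε, hσ, himg', heq'⟩ := hG J δ hδ
  have hm : ∀ t ∈ I, τ t ∈ J := fun t ht => himg ▸ mem_image_of_mem τ ht
  refine ⟨K, ε, fun t => σ (τ t), hε, ?_, ?_, ?_⟩
  · intro a ha b hb hab
    exact hσ (hm a ha) (hm b hb) (hτ ha hb hab)
  · rw [← himg', ← himg, image_image]
  · intro t ht
    show G (H (γ t)) = ε (σ (τ t))
    rw [heq t ht, heq' _ (hm t ht)]

/-- Topological equivalence is an equivalence relation on the vector fields on ℝ². -/
def topologicalEquivalence : Setoid (Plane → Plane) where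
  r := TopologicallyEquivalent
  iseqv :=
    { refl := fun X => ⟨Homeomorph.refl Plane, MapsOrbits.refl X, MapsOrbits.refl X⟩
      symm := fun ⟨H, h, h'⟩ => ⟨H.symm, h', h⟩
      trans := fun ⟨H, h, h'⟩ ⟨G, g, g'⟩ => ⟨H.trans G, g.comp h, h'.comp g'⟩ }

/-- The phase portrait of a vector field is its class for topological equivalence. -/
def phasePortrait (X : Plane → Plane) : Quotient (topologicalEquivalence) :=
  Quotient.mk (topologicalEquivalence) X

/-- `p` is a hyperbolic singularity of `X`: a zero of `X` at which `X` has a linearization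
without eigenvalues (in `ℂ`) on the imaginary axis. -/
def IsHyperbolicSingularity (X : Plane → Plane) (p : Plane) : Prop :=
  X p = 0 ∧ ∃ A : Plane →L[ℝ] Plane, HasFDerivAt X A p ∧
    ∀ z : ℂ, Polynomial.aeval z (LinearMap.charpoly (A : Plane →ₗ[ℝ] Plane)) = 0 → z.re ≠ 0

/-- The field `y ∂x + (1/Λ) (c y + sign(x) |x|^α) ∂y` on the plane, where `sign 0 = 0`. -/
noncomputable def extendedField (c α Λ : ℝ) (p : Plane) : Plane :=
  (p.2, (1 / Λ) * (c * p.2 + Real.sign p.1 * |p.1| ^ α))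

/-- The linear saddle `y ∂x + x ∂y`. -/
def linearSaddle (p : Plane) : Plane := (p.2, p.1)

end PhasePortrait

/-! Along an orbit of y ∂x + (a y + sign(x) g(|x|)) ∂y one has dy/dx = a + sign(x) g(|x|)/y, so up
to reflections in the axes the orbits in each open quadrant are graphs of positive solutions
("profiles") of y' = b + g/y with b = ±a. The right-hand side does not increase with y, so profiles
approach each other to the right. This yields uniqueness, even for a start on y = 0 where the
equation is singular, and continuity in the starting point. The profiles starting on the two
bounding half-axes thus fill a quadrant exactly as the hyperbolas η² - x² = k do for the linear
saddle.

Keep x and send each hyperbola to the profile with the same starting point. This map is the identity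
on both axes and an increasing bijection on each vertical line, so its four quadrant versions glue
to a homeomorphism, `straightening`.

Orbits are maximal trajectories in integrated form, and the field may be discontinuous, so no
general uniqueness theorem applies. Two facts replace it: the image of a saddle orbit, with time
rescaled by `timeRatio`, is a trajectory (`isRegularTrajectory_orbitCurve`); and every regular
trajectory is part of such a curve (`IsRegularTrajectory.eqOn_orbitCurve`), because it preserves the
level η² - x² in straightened coordinates. Hence any two forced fields are equivalent by way of the
saddle, in particular those with g(x) = |x|^α/Λ. For α < 1 the difference quotients x^(α-1)/Λ at 0
are unbounded, which excludes a derivative at the origin. -/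

namespace PhasePortrait

open Set MeasureTheory Filter Topology

/-! ### Profiles: comparison, uniqueness and existence for y' = b + g/y. -/

/-- The restoring forces `x ↦ g |x|` of the fields under consideration. -/
structure IsForce (g : ℝ → ℝ) : Prop where
  continuous : Continuous g
  nonneg : ∀ x, 0 ≤ g x
  pos : ∀ x, 0 < x → 0 < g x
  mono : MonotoneOn g (Ici 0)

/-- `y` is a nonnegative solution on `[r, R]` of `y' = b + g / y`, positive in the interior. -/
structure IsProfileOn (b : ℝ) (g : ℝ → ℝ) (r R : ℝ) (y : ℝ → ℝ) : Prop where
  continuousOn : ContinuousOn y (Icc r R)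
  nonneg : 0 ≤ y r
  pos : ∀ x ∈ Ioo r R, 0 < y x
  hasDerivAt : ∀ x ∈ Ioo r R, HasDerivAt y (b + g x / y x) x

/-- `y` is a nonnegative solution on `[r, ∞)` of `y' = b + g / y`, positive in the interior. -/
structure IsProfile (b : ℝ) (g : ℝ → ℝ) (r : ℝ) (y : ℝ → ℝ) : Prop where
  continuousOn : ContinuousOn y (Ici r)
  nonneg : 0 ≤ y r
  pos : ∀ x, r < x → 0 < y x
  hasDerivAt : ∀ x, r < x → HasDerivAt y (b + g x / y x) x

variable {b : ℝ} {g : ℝ → ℝ} {r R : ℝ} {y y₁ y₂ : ℝ → ℝ}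

theorem IsProfile.profileOn (h : IsProfile b g r y) (R : ℝ) : IsProfileOn b g r R y :=
  ⟨h.continuousOn.mono Icc_subset_Ici_self, h.nonneg, fun x hx => h.pos x hx.1,
    fun x hx => h.hasDerivAt x hx.1⟩

theorem IsProfile.nonneg_of_le (h : IsProfile b g r y) {x : ℝ} (hx : r ≤ x) : 0 ≤ y x := by
  rcases hx.eq_or_lt with rfl | hx
  · exact h.nonneg
  · exact (h.pos x hx).le

theorem IsProfile.restrict (h : IsProfile b g r y) {r' : ℝ} (hr : r ≤ r') : IsProfile b g r' y :=
  ⟨h.continuousOn.mono (Ici_subset_Ici.2 hr), h.nonneg_of_le hr,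
    fun x hx => h.pos x (hr.trans_lt hx), fun x hx => h.hasDerivAt x (hr.trans_lt hx)⟩

theorem IsProfileOn.restrict (h : IsProfileOn b g r R y) {r' R' : ℝ} (hr : r ≤ r') (hr' : r' < R)
    (hR : R' ≤ R) : IsProfileOn b g r' R' y := by
  refine ⟨h.continuousOn.mono (Icc_subset_Icc hr hR), ?_,
    fun x hx => h.pos x ⟨hr.trans_lt hx.1, hx.2.trans_le hR⟩,
    fun x hx => h.hasDerivAt x ⟨hr.trans_lt hx.1, hx.2.trans_le hR⟩⟩
  rcases hr.eq_or_lt with rfl | hx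
  · exact h.nonneg
  · exact (h.pos r' ⟨hx, hr'⟩).le

/-- The right-hand side decreases in `y`, so the distance of two solutions decreases. -/
theorem IsProfileOn.antitoneOn_sq (hg : IsForce g) (h₁ : IsProfileOn b g r R y₁)
    (h₂ : IsProfileOn b g r R y₂) : AntitoneOn (fun x => (y₁ x - y₂ x) ^ 2) (Icc r R) := by
  have hd : ∀ x ∈ Ioo r R, HasDerivAt (fun x => (y₁ x - y₂ x) ^ 2)
      (2 * (y₁ x - y₂ x) * ((b + g x / y₁ x) - (b + g x / y₂ x))) x := fun x hx => by
    have := ((h₁.hasDerivAt x hx).sub (h₂.hasDerivAt x hx)).pow 2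
    refine this.congr_deriv ?_
    simp
  refine antitoneOn_of_deriv_nonpos (convex_Icc r R)
    ((h₁.continuousOn.sub h₂.continuousOn).pow 2) ?_ ?_
  · rw [interior_Icc]
    exact fun x hx => (hd x hx).differentiableAt.differentiableWithinAt
  · rw [interior_Icc]
    intro x hx
    rw [(hd x hx).deriv]
    have p₁ := h₁.pos x hx
    have p₂ := h₂.pos x hx
    have : 2 * (y₁ x - y₂ x) * ((b + g x / y₁ x) - (b + g x / y₂ x)) =
        - (2 * (y₁ x - y₂ x) ^ 2 * g x / (y₁ x * y₂ x)) := by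
      field_simp
      ring
    rw [this, neg_nonpos]
    have := hg.nonneg x
    positivity

theorem IsProfileOn.abs_sub_le (hg : IsForce g) (h₁ : IsProfileOn b g r R y₁)
    (h₂ : IsProfileOn b g r R y₂) {s x : ℝ} (hs : r ≤ s) (hsx : s ≤ x) (hx : x ≤ R) :
    |y₁ x - y₂ x| ≤ |y₁ s - y₂ s| :=
  sq_le_sq.1 (h₁.antitoneOn_sq hg h₂ ⟨hs, hsx.trans hx⟩ ⟨hs.trans hsx, hx⟩ hsx)

theorem IsProfileOn.eqOn (hg : IsForce g) (h₁ : IsProfileOn b g r R y₁)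
    (h₂ : IsProfileOn b g r R y₂) (h : y₁ r = y₂ r) : EqOn y₁ y₂ (Icc r R) := fun x hx => by
  have := h₁.abs_sub_le hg h₂ le_rfl hx.1 hx.2
  rw [h, sub_self, abs_zero] at this
  exact sub_eq_zero.1 (abs_nonpos_iff.1 this)

/-- For the order to be reversed the graphs would have to meet, and from a meeting point on the
contraction makes them coincide. -/
theorem IsProfileOn.le_of_le (hg : IsForce g) (h₁ : IsProfileOn b g r R y₁)
    (h₂ : IsProfileOn b g r R y₂) (h : y₁ r ≤ y₂ r) {x : ℝ} (hx : x ∈ Icc r R) :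
    y₁ x ≤ y₂ x := by
  by_contra! hlt
  obtain ⟨z, hz, hz0⟩ : (0 : ℝ) ∈ (fun x => y₁ x - y₂ x) '' Icc r x := by
    refine intermediate_value_Icc hx.1 ?_ ⟨by simpa using h, by simpa using hlt.le⟩
    exact (h₁.continuousOn.sub h₂.continuousOn).mono (Icc_subset_Icc_right hx.2)
  have := h₁.abs_sub_le hg h₂ hz.1 hz.2 hx.2
  simp only at hz0
  rw [hz0, abs_zero] at this
  linarith [abs_nonpos_iff.1 this]

/-- The difference d = y₂ - y₁ satisfies d' = -q d with q = g/(y₁ y₂). If q ≤ Q on a compact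
interval, then d e^(Qx) is nondecreasing there and stays positive. The interval begins at some s > r
because y₁ may vanish at r, where q could blow up. -/
theorem IsProfileOn.lt_of_lt (hg : IsForce g) (h₁ : IsProfileOn b g r R y₁)
    (h₂ : IsProfileOn b g r R y₂) (h : y₁ r < y₂ r) {x : ℝ} (hx : x ∈ Ico r R) :
    y₁ x < y₂ x := by
  rcases hx.1.eq_or_lt with rfl | hrx
  · exact h
  have hle : ∀ z ∈ Icc r R, y₁ z ≤ y₂ z := fun z hz => h₁.le_of_le hg h₂ h.le hz
  have hcD := h₁.continuousOn.sub h₂.continuousOn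
  obtain ⟨s, hs, hsx⟩ : ∃ s ∈ Ioo r x, y₁ s < y₂ s := by
    have hev : ∀ᶠ z in 𝓝[>] r, y₁ z < y₂ z := by
      have hc : ∀ᶠ z in 𝓝[Icc r R] r, y₁ z - y₂ z < 0 :=
        (hcD r ⟨le_rfl, (hrx.trans hx.2).le⟩).eventually_lt_const (by simpa using h)
      have hle : 𝓝[>] r ≤ 𝓝[Icc r R] r := by
        rw [← nhdsWithin_Ioc_eq_nhdsGT (hrx.trans hx.2)]
        exact nhdsWithin_mono _ Ioc_subset_Icc_self
      filter_upwards [hle hc] with z hz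
      simpa using hz
    obtain ⟨s, h1, h2⟩ := (hev.and (Ioo_mem_nhdsGT hrx)).exists
    exact ⟨s, h2, h1⟩
  have hsub : ∀ z ∈ Icc s x, z ∈ Ioo r R := fun z hz =>
    ⟨hs.1.trans_le hz.1, hz.2.trans_lt hx.2⟩
  have hq : ContinuousOn (fun z => g z / (y₁ z * y₂ z)) (Icc s x) := by
    refine hg.continuous.continuousOn.div ?_ fun z hz =>
      (mul_pos (h₁.pos z (hsub z hz)) (h₂.pos z (hsub z hz))).ne'
    exact (h₁.continuousOn.mul h₂.continuousOn).mono
      fun z hz => Ioo_subset_Icc_self (hsub z hz)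
  obtain ⟨Q, hQ⟩ := isCompact_Icc.bddAbove_image hq
  have hd : ∀ z ∈ Icc s x, HasDerivAt (fun z => (y₂ z - y₁ z) * Real.exp (Q * z))
      ((Q - g z / (y₁ z * y₂ z)) * (y₂ z - y₁ z) * Real.exp (Q * z)) z := fun z hz => by
    have := ((h₂.hasDerivAt z (hsub z hz)).sub (h₁.hasDerivAt z (hsub z hz))).mul
      (((hasDerivAt_id z).const_mul Q).exp)
    refine this.congr_deriv ?_
    have p₁ := h₁.pos z (hsub z hz)
    have p₂ := h₂.pos z (hsub z hz)
    simp only [id, Pi.sub_apply]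
    field_simp
    ring
  have hmono : MonotoneOn (fun z => (y₂ z - y₁ z) * Real.exp (Q * z)) (Icc s x) := by
    refine monotoneOn_of_deriv_nonneg (convex_Icc s x)
      (fun z hz => (hd z hz).continuousAt.continuousWithinAt) ?_ ?_
    · rw [interior_Icc]
      exact fun z hz =>
        (hd z (Ioo_subset_Icc_self hz)).differentiableAt.differentiableWithinAt
    · rw [interior_Icc]
      intro z hz
      have hz := Ioo_subset_Icc_self hz
      rw [(hd z hz).deriv]
      have h1 : g z / (y₁ z * y₂ z) ≤ Q := hQ (mem_image_of_mem _ hz)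
      have h2 := hle z (Ioo_subset_Icc_self (hsub z hz))
      exact mul_nonneg (mul_nonneg (sub_nonneg.2 h1) (sub_nonneg.2 h2)) (Real.exp_pos _).le
  have h3 := hmono ⟨le_rfl, hs.2.le⟩ ⟨hs.2.le, le_rfl⟩ hs.2.le
  simp only at h3
  have h4 : 0 < (y₂ s - y₁ s) * Real.exp (Q * s) := mul_pos (by linarith) (Real.exp_pos _)
  have h5 := pos_of_mul_pos_left (h4.trans_le h3) (Real.exp_pos (Q * x)).le
  linarith

/-- Solutions of the equation regularized at `y = 0` exist on every interval. -/
theorem exists_regularized_solution (hg : IsForce g) (b : ℝ) {r R : ℝ} (hrR : r ≤ R) (h : ℝ)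
    {ε : ℝ} (hε : 0 < ε) :
    ∃ y : ℝ → ℝ, y r = h ∧
      ∀ x ∈ Icc r R, HasDerivWithinAt y (b + g x / max (y x) ε) (Icc r R) x := by
  obtain ⟨G, hG⟩ := isCompact_Icc.bddAbove_image (hg.continuous.continuousOn (s := Icc r R))
  have hG' : ∀ x ∈ Icc r R, g x ≤ G := fun x hx => hG (mem_image_of_mem _ hx)
  have hG0 : 0 ≤ G := (hg.nonneg r).trans (hG' r ⟨le_rfl, hrR⟩)
  have hm : ∀ z : ℝ, 0 < max z ε := fun z => hε.trans_le (le_max_right _ _)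
  have hL : 0 ≤ |b| + G / ε := by positivity
  -- The radius is the bound of the right-hand side times the length R - r, so one application
  -- covers the whole interval; G/ε² is the Lipschitz constant in z.
  have hP : IsPicardLindelof (fun x z => b + g x / max z ε) (⟨r, le_rfl, hrR⟩ : Icc r R) h
      (Real.toNNReal ((|b| + G / ε) * (R - r))) 0 (Real.toNNReal (|b| + G / ε))
      (Real.toNNReal (G / ε ^ 2)) := by
    refine ⟨fun x hx => ?_, fun z _ => ?_, fun x hx z _ => ?_, ?_⟩
    · refine LipschitzOnWith.of_dist_le_mul fun z _ w _ => ?_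
      rw [Real.coe_toNNReal _ (by positivity), Real.dist_eq, Real.dist_eq]
      have hz := hm z
      have hw := hm w
      have h1 : b + g x / max z ε - (b + g x / max w ε) =
          g x * (max w ε - max z ε) / (max z ε * max w ε) := by
        field_simp
        ring
      rw [h1, abs_div, abs_mul, abs_of_nonneg (hg.nonneg x), abs_of_pos (mul_pos hz hw)]
      have h2 : |max w ε - max z ε| ≤ |z - w| := by
        rw [abs_sub_comm z w]
        exact abs_max_sub_max_le_abs w z ε
      have h3 : ε ^ 2 ≤ max z ε * max w ε := by
        rw [sq]
        exact mul_le_mul (le_max_right _ _) (le_max_right _ _) hε.le hz.le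
      calc g x * |max w ε - max z ε| / (max z ε * max w ε)
          ≤ G * |z - w| / ε ^ 2 := by
            gcongr
            exact hG' x hx
        _ = G / ε ^ 2 * |z - w| := by ring
    · exact (continuous_const.add (hg.continuous.div_const _)).continuousOn
    · rw [Real.coe_toNNReal _ hL, Real.norm_eq_abs]
      refine (abs_add_le _ _).trans ?_
      gcongr
      rw [abs_of_nonneg (div_nonneg (hg.nonneg x) (hm z).le)]
      gcongr
      · exact hG' x hx
      · exact le_max_right _ _
    · have hRr : 0 ≤ R - r := sub_nonneg.2 hrR
      rw [Real.coe_toNNReal _ hL, Real.coe_toNNReal _ (by positivity)]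
      simp [hRr]
  exact hP.exists_eq_forall_mem_Icc_hasDerivWithinAt₀

/-- The regularization never becomes active. Since y' > -(|b| + 1), falling from h to ε ≤ h/2 takes
a length of at least h/(2(|b| + 1)). From there on g ≥ m ≥ (|b| + 1)ε by monotonicity, so y' > 0
wherever y = ε, and ε is a lower barrier. -/
theorem exists_profileOn_of_pos (hg : IsForce g) (b : ℝ) {r R h : ℝ} (hr : 0 ≤ r) (hrR : r ≤ R)
    (hh : 0 < h) : ∃ y, IsProfileOn b g r R y ∧ y r = h := by
  have hx₁ : 0 < r + h / (2 * (|b| + 1)) := by positivity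
  obtain ⟨m, hm, hmb⟩ : ∃ m, 0 < m ∧ m ≤ g (r + h / (2 * (|b| + 1))) := ⟨_, hg.pos _ hx₁, le_rfl⟩
  obtain ⟨ε, hε, hεh, hεm⟩ : ∃ ε, 0 < ε ∧ ε ≤ h / 2 ∧ (|b| + 1) * ε ≤ m := by
    refine ⟨min (h / 2) (m / (|b| + 1)), by positivity, min_le_left _ _, ?_⟩
    rw [← le_div_iff₀' (by positivity)]
    exact min_le_right _ _
  obtain ⟨y, hyr, hy⟩ := exists_regularized_solution hg b hrR h hε
  have hc : ContinuousOn y (Icc r R) := fun x hx => (hy x hx).continuousWithinAt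
  have hy' : ∀ x ∈ Ico r R, HasDerivWithinAt y (b + g x / max (y x) ε) (Ici x) x := fun x hx =>
    ((hy x ⟨hx.1, hx.2.le⟩).mono (Icc_subset_Icc_left hx.1)).mono_of_mem_nhdsWithin
      (Icc_mem_nhdsGE hx.2)
  have hm0 : ∀ z : ℝ, 0 < max z ε := fun z => hε.trans_le (le_max_right _ _)
  have hlow : ∀ x ∈ Icc r R, h - (|b| + 1) * (x - r) ≤ y x := by
    intro x hx
    have := image_le_of_deriv_right_lt_deriv_boundary'
      (f := fun x => h - (|b| + 1) * (x - r)) (f' := fun _ => -(|b| + 1)) (B := y) (by fun_prop)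
      (fun z _ => ?_) (by simp [hyr]) hc hy' (fun z hz _ => ?_) hx
    · simpa using this
    · have : HasDerivAt (fun x => h - (|b| + 1) * (x - r)) (-((|b| + 1) * 1)) z :=
        (((hasDerivAt_id z).sub_const r).const_mul (|b| + 1)).const_sub h
      simpa using this.hasDerivWithinAt
    · have h1 := div_nonneg (hg.nonneg z) (hm0 (y z)).le
      have h2 := neg_abs_le b
      linarith
  have hε' : ∀ x ∈ Icc r R, ε ≤ y x := by
    intro x hx
    refine image_le_of_deriv_right_lt_deriv_boundary' (f := fun _ => ε) (f' := fun _ => 0)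
      (B := y) continuousOn_const (fun z _ => hasDerivWithinAt_const _ _ _) (by linarith) hc hy'
      (fun z hz hez => ?_) hx
    rw [← hez, max_self]
    have h1 := hlow z ⟨hz.1, hz.2.le⟩
    have h2 : r + h / (2 * (|b| + 1)) ≤ z := by
      have : h / 2 ≤ (|b| + 1) * (z - r) := by linarith
      have h3 : h / (2 * (|b| + 1)) ≤ z - r := by
        rw [div_le_iff₀ (by positivity)]
        linarith
      linarith
    have h3 : m ≤ g z := hmb.trans (hg.mono hx₁.le (hx₁.le.trans h2) h2)
    have h4 : |b| + 1 ≤ g z / ε := by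
      rw [le_div_iff₀ hε]
      linarith
    linarith [neg_abs_le b]
  refine ⟨y, ⟨hc, by rw [hyr]; exact hh.le, fun x hx => ?_, fun x hx => ?_⟩, hyr⟩
  · exact hε.trans_le (hε' x (Ioo_subset_Icc_self hx))
  · have := (hy x (Ioo_subset_Icc_self hx)).hasDerivAt (Icc_mem_nhds hx.1 hx.2)
    rwa [max_eq_left (hε' x (Ioo_subset_Icc_self hx))] at this

theorem IsProfileOn.congr (h : IsProfileOn b g r R y₁) (hrR : r ≤ R)
    (heq : EqOn y₂ y₁ (Icc r R)) : IsProfileOn b g r R y₂ := by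
  refine ⟨h.continuousOn.congr heq, ?_, fun x hx => ?_, fun x hx => ?_⟩
  · rw [heq ⟨le_rfl, hrR⟩]; exact h.nonneg
  · rw [heq (Ioo_subset_Icc_self hx)]; exact h.pos x hx
  · rw [heq (Ioo_subset_Icc_self hx)]
    exact (h.hasDerivAt x hx).congr_of_eventuallyEq
      (heq.eventuallyEq_of_mem (Icc_mem_nhds hx.1 hx.2))

theorem isProfile_of_forall (h : ∀ R, r < R → IsProfileOn b g r R y) : IsProfile b g r y := by
  refine ⟨fun x hx => ?_, (h (r + 1) (by linarith)).nonneg, fun x hx => ?_, fun x hx => ?_⟩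
  · have hx : r ≤ x := hx
    have := (h (x + 1) (by linarith)).continuousOn x ⟨hx, by linarith⟩
    refine this.mono_of_mem_nhdsWithin ?_
    rw [← Ici_inter_Iic]
    exact inter_mem_nhdsWithin _ (Iic_mem_nhds (by linarith))
  · exact (h (x + 1) (by linarith)).pos x ⟨hx, by linarith⟩
  · exact (h (x + 1) (by linarith)).hasDerivAt x ⟨hx, by linarith⟩

theorem exists_profile_of_pos (hg : IsForce g) (b : ℝ) {r h : ℝ} (hr : 0 ≤ r) (hh : 0 < h) :
    ∃ y, IsProfile b g r y ∧ y r = h := by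
  have hn : ∀ n : ℕ, r ≤ r + n := fun n => by simp
  choose z hz hzr using fun n : ℕ => exists_profileOn_of_pos hg b hr (hn n) hh
  have hzz : ∀ m n : ℕ, m ≤ n → EqOn (z n) (z m) (Icc r (r + m)) := fun m n hmn => by
    rcases m.eq_zero_or_pos with rfl | hm
    · intro x hx
      have : x = r := le_antisymm (by simpa using hx.2) hx.1
      rw [this, hzr, hzr]
    have hm' : (0 : ℝ) < m := by exact_mod_cast hm
    have hmn' : (m : ℝ) ≤ n := by exact_mod_cast hmn
    exact ((hz n).restrict le_rfl (by linarith) (by linarith)).eqOn hg (hz m)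
      (by rw [hzr, hzr])
  -- By uniqueness the solutions on the intervals [r, r + n] agree on overlaps; the ceiling picks
  -- one whose interval contains x.
  refine ⟨fun x => z ⌈x - r⌉₊ x, isProfile_of_forall fun R hR => ?_, by simp [hzr]⟩
  have hceil : R ≤ r + ⌈R - r⌉₊ := by linarith [Nat.le_ceil (R - r)]
  refine ((hz ⌈R - r⌉₊).restrict le_rfl (by linarith) hceil).congr hR.le fun x hx => ?_
  refine (hzz ⌈x - r⌉₊ ⌈R - r⌉₊ (Nat.ceil_mono (by linarith [hx.2])) ⟨hx.1, ?_⟩).symm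
  linarith [Nat.le_ceil (x - r)]

/-- In terms of y² the equation has no singularity at y = 0, so limits and estimates near the x-axis
are carried out for y². -/
theorem IsProfile.hasDerivAt_sq (h : IsProfile b g r y) {x : ℝ} (hx : r < x) :
    HasDerivAt (fun x => y x ^ 2) (2 * (b * y x + g x)) x := by
  refine ((h.hasDerivAt x hx).pow 2).congr_deriv ?_
  have := h.pos x hx
  simp only [Nat.cast_ofNat, Nat.add_one_sub_one, pow_one]
  field_simp

/-- A start at height 0 is the limit of starts at heights 1/(n + 1). The contraction makes the
convergence uniform, and the derivatives of the squares converge uniformly too. The limit is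
positive beyond r: a zero would be a minimum of y², where (y²)' = 2g > 0. -/
theorem exists_profile (hg : IsForce g) (b : ℝ) {r h : ℝ} (hr : 0 ≤ r) (hh : 0 ≤ h) :
    ∃ y, IsProfile b g r y ∧ y r = h := by
  rcases hh.eq_or_lt with rfl | hh
  swap
  · exact exists_profile_of_pos hg b hr hh
  choose z hz hzr using fun n : ℕ => exists_profile_of_pos hg b hr (Nat.one_div_pos_of_nat (n := n))
  have hzz : ∀ m n : ℕ, m ≤ n → ∀ x, r ≤ x → |z m x - z n x| ≤ 1 / ((m : ℝ) + 1) := by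
    intro m n hmn x hx
    refine (((hz m).profileOn x).abs_sub_le hg ((hz n).profileOn x) le_rfl hx le_rfl).trans ?_
    have h1 := Nat.one_div_le_one_div (α := ℝ) hmn
    have h2 : 0 < 1 / ((n : ℝ) + 1) := Nat.one_div_pos_of_nat
    rw [hzr, hzr, abs_of_nonneg (by linarith)]
    linarith
  have hlim : ∀ x, ∃ l, r ≤ x → Tendsto (fun n => z n x) atTop (𝓝 l) := by
    intro x
    by_cases hx : r ≤ x
    · obtain ⟨l, hl⟩ := cauchySeq_tendsto_of_complete (u := fun n => z n x)
        (cauchySeq_of_le_tendsto_0' (fun n : ℕ => 1 / ((n : ℝ) + 1))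
          (fun m n hmn => hzz m n hmn x hx) tendsto_one_div_add_atTop_nhds_zero_nat)
      exact ⟨l, fun _ => hl⟩
    · exact ⟨0, fun h => absurd h hx⟩
  choose y hy using hlim
  have hzy : ∀ n, ∀ x, r ≤ x → |z n x - y x| ≤ 1 / ((n : ℝ) + 1) := fun n x hx =>
    le_of_tendsto ((tendsto_const_nhds.sub (hy x hx)).abs)
      (eventually_atTop.2 ⟨n, fun m hm => hzz n m hm x hx⟩)
  have hu : ∀ C : ℝ, 0 < C → ∀ ε > 0, ∀ᶠ n : ℕ in atTop, C * (1 / ((n : ℝ) + 1)) < ε :=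
      fun C hC ε hε => by
    have := tendsto_one_div_add_atTop_nhds_zero_nat (𝕜 := ℝ).const_mul C
    rw [mul_zero] at this
    exact this.eventually_lt_const hε
  have hunif : TendstoUniformlyOn z y atTop (Ici r) := by
    rw [Metric.tendstoUniformlyOn_iff]
    intro ε hε
    filter_upwards [hu 1 one_pos ε hε] with n hn x hx
    rw [dist_comm, Real.dist_eq]
    have := hzy n x hx
    linarith
  have hyr : y r = 0 := by
    refine tendsto_nhds_unique (hy r le_rfl) ?_
    simp only [hzr]
    exact tendsto_one_div_add_atTop_nhds_zero_nat
  have hy0 : ∀ x, r ≤ x → 0 ≤ y x := fun x hx =>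
    ge_of_tendsto' (hy x hx) fun n => (hz n).nonneg_of_le hx
  have hsq : ∀ x, r < x → HasDerivAt (fun x => y x ^ 2) (2 * (b * y x + g x)) x := by
    intro x hx
    refine hasDerivAt_of_tendstoUniformlyOn (f := fun n x => z n x ^ 2)
      (f' := fun n x => 2 * (b * z n x + g x))
      (g' := fun x => 2 * (b * y x + g x)) isOpen_Ioi ?_
      (Eventually.of_forall fun n x hx => (hz n).hasDerivAt_sq hx)
      (fun x hx => (hy x (le_of_lt hx)).pow 2) hx
    rw [Metric.tendstoUniformlyOn_iff]
    intro ε hε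
    filter_upwards [hu (2 * (|b| + 1)) (by positivity) ε hε] with n hn w hw
    rw [dist_comm, Real.dist_eq]
    have h1 := hzy n w (le_of_lt hw)
    have h2 : 2 * (b * z n w + g w) - 2 * (b * y w + g w) = 2 * (b * (z n w - y w)) := by ring
    rw [h2, abs_mul, abs_mul, abs_two]
    refine lt_of_le_of_lt ?_ hn
    rw [mul_assoc]
    gcongr
    linarith
  have hpos : ∀ x, r < x → 0 < y x := by
    intro x hx
    refine lt_of_le_of_ne (hy0 x hx.le) fun h0 => ?_
    have hmin : IsLocalMin (fun x => y x ^ 2) x :=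
      Eventually.of_forall fun w => by simpa [← h0] using sq_nonneg (y w)
    have h1 := hmin.hasDerivAt_eq_zero (hsq x hx)
    rw [← h0] at h1
    linarith [hg.pos x (hr.trans_lt hx)]
  refine ⟨y, ⟨hunif.continuousOn (Frequently.of_forall fun n => (hz n).continuousOn), hyr.ge, hpos,
    fun x hx => ?_⟩, hyr⟩
  have hp := hpos x hx
  have h1 := (hsq x hx).sqrt (by positivity)
  rw [Real.sqrt_sq hp.le] at h1
  refine (h1.congr_deriv (by field_simp)).congr_of_eventuallyEq ?_
  filter_upwards [Ioi_mem_nhds hx] with w hw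
  rw [Real.sqrt_sq (hy0 w (le_of_lt hw))]

end PhasePortrait

/-! ### The profiles as a continuous family indexed by the level k. -/

namespace PhasePortrait

open Set MeasureTheory Filter Topology

/-- The profile starting at height `√k` over `0` if `k ≥ 0`, and at height `0` over `√(-k)`
if `k ≤ 0`. -/
noncomputable def levelProfile (b : ℝ) (g : ℝ → ℝ) (k : ℝ) : ℝ → ℝ :=
  Classical.epsilon fun y => IsProfile b g √(-k) y ∧ y √(-k) = √k

variable {b : ℝ} {g : ℝ → ℝ} {r R : ℝ} {y y₁ y₂ : ℝ → ℝ}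

theorem levelProfile_spec (hg : IsForce g) (b k : ℝ) :
    IsProfile b g √(-k) (levelProfile b g k) ∧ levelProfile b g k √(-k) = √k :=
  Classical.epsilon_spec (exists_profile hg b (Real.sqrt_nonneg _) (Real.sqrt_nonneg _))

/-- As `√` vanishes on negative numbers, (√(-k), √k) runs along the boundary of the quadrant, down
to the origin for k = 0. The comparison begins at √(-k), where the profile of lower level starts. -/
theorem levelProfile_lt (hg : IsForce g) (b : ℝ) {k k' : ℝ} (hk : k < k') {x : ℝ}
    (hx : √(-k) ≤ x) : levelProfile b g k x < levelProfile b g k' x := by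
  obtain ⟨h, hs⟩ := levelProfile_spec hg b k
  obtain ⟨h', hs'⟩ := levelProfile_spec hg b k'
  have hr : √(-k') ≤ √(-k) := Real.sqrt_le_sqrt (by linarith)
  refine (h.profileOn (x + 1)).lt_of_lt hg ((h'.restrict hr).profileOn (x + 1)) ?_ ⟨hx, by simp⟩
  rw [hs]
  rcases le_or_gt 0 k with hk0 | hk0
  · have e : √(-k) = √(-k') := by
      rw [Real.sqrt_eq_zero_of_nonpos (by linarith), Real.sqrt_eq_zero_of_nonpos (by linarith)]
    rw [e, hs']
    exact Real.sqrt_lt_sqrt hk0 hk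
  · rw [Real.sqrt_eq_zero_of_nonpos hk0.le]
    exact h'.pos _ (Real.sqrt_lt_sqrt_iff_of_pos (by linarith) |>.2 (by linarith))

/-- `levelProfile`, extended by a constant to the left of its starting point. -/
noncomputable def extProfile (b : ℝ) (g : ℝ → ℝ) (k x : ℝ) : ℝ :=
  levelProfile b g k (max x √(-k))

theorem continuous_extProfile (hg : IsForce g) (b k : ℝ) : Continuous (extProfile b g k) :=
  (levelProfile_spec hg b k).1.continuousOn.comp_continuous
    (continuous_id.max continuous_const) fun _ => mem_Ici.2 (le_max_right _ _)

theorem extProfile_of_le {k x : ℝ} (h : √(-k) ≤ x) :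
    extProfile b g k x = levelProfile b g k x := by
  rw [extProfile, max_eq_left h]

/-- This is a modulus of continuity in k, uniform in x. By contraction only the gap at √(-k)
matters. For k ≥ 0 it is √k' - √k; for k < 0 it is bounded by integrating (y²)' ≤ C for the profile
of level k' from its own start. The constant C comes from the profile of level M, which dominates
the others on [0, √M]. -/
theorem extProfile_estimate (hg : IsForce g) (b : ℝ) {M : ℝ} (hM : 0 ≤ M) :
    ∃ C, 0 ≤ C ∧ ∀ k k', -M ≤ k → k < k' → k' ≤ M → ∀ x,
      |extProfile b g k x - extProfile b g k' x| ≤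
        (√k' - √k) + √(C * (√(-k) - √(-k'))) := by
  have hcont : ContinuousOn (fun x => 2 * (|b| * extProfile b g M x + g x)) (Icc 0 √M) := by
    have := continuous_extProfile hg b M
    have := hg.continuous
    fun_prop
  obtain ⟨C, hC⟩ := isCompact_Icc.bddAbove_image hcont
  have hC' : ∀ x ∈ Icc 0 √M, 2 * (|b| * levelProfile b g M x + g x) ≤ C := fun x hx => by
    have := hC (mem_image_of_mem _ hx)
    rwa [extProfile_of_le] at this
    rw [Real.sqrt_eq_zero_of_nonpos (by linarith)]
    exact hx.1
  refine ⟨max C 0, le_max_right _ _, fun k k' hk hkk' hk' x => ?_⟩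
  obtain ⟨h, hs⟩ := levelProfile_spec hg b k
  obtain ⟨h', hs'⟩ := levelProfile_spec hg b k'
  have hr : √(-k') ≤ √(-k) := Real.sqrt_le_sqrt (by linarith)
  have hsk : √k ≤ √k' := Real.sqrt_le_sqrt hkk'.le
  have hcontr : √(-k) ≤ x →
      |extProfile b g k x - extProfile b g k' x| ≤ |√k - levelProfile b g k' √(-k)| := by
    intro hx
    rw [extProfile_of_le hx, extProfile_of_le (hr.trans hx), ← hs]
    exact (h.profileOn x).abs_sub_le hg ((h'.restrict hr).profileOn x) le_rfl hx le_rfl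
  rcases le_or_gt 0 k with hk0 | hk0
  · have e : √(-k) = √(-k') := by
      rw [Real.sqrt_eq_zero_of_nonpos (by linarith), Real.sqrt_eq_zero_of_nonpos (by linarith)]
    have hle : |extProfile b g k x - extProfile b g k' x| ≤ |√k - √k'| := by
      rcases le_total √(-k) x with hx | hx
      · have := hcontr hx
        rwa [e, hs'] at this
      · rw [extProfile, extProfile, ← e, max_eq_right hx, hs, e, hs']
    rw [abs_of_nonpos (by linarith : √k - √k' ≤ 0)] at hle
    have := Real.sqrt_nonneg (max C 0 * (√(-k) - √(-k')))
    linarith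
  · have hsk0 : √k = 0 := Real.sqrt_eq_zero_of_nonpos hk0.le
    have hrM : √(-k) ≤ √M := Real.sqrt_le_sqrt (by linarith)
    have key : ∀ z ∈ Icc √(-k') √(-k),
        |levelProfile b g k' z| ≤ √k' + √(max C 0 * (√(-k) - √(-k'))) := by
      intro z hz
      have hCpos := le_max_right C 0
      have h1 : levelProfile b g k' z ^ 2 - levelProfile b g k' √(-k') ^ 2 ≤
          max C 0 * (z - √(-k')) := by
        have hd : ∀ w ∈ Ioo √(-k') z, HasDerivAt (fun x => levelProfile b g k' x ^ 2)
          (2 * (b * levelProfile b g k' w + g w)) w := fun w hw => h'.hasDerivAt_sq hw.1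
        refine Convex.image_sub_le_mul_sub_of_deriv_le (f := fun x => levelProfile b g k' x ^ 2)
          (convex_Icc √(-k') z)
          ((h'.continuousOn.mono Icc_subset_Ici_self).pow 2) ?_ ?_ _ ⟨le_rfl, hz.1⟩ _
          ⟨hz.1, le_rfl⟩ hz.1
        · rw [interior_Icc]
          exact fun w hw => (hd w hw).differentiableAt.differentiableWithinAt
        · rw [interior_Icc]
          intro w hw
          rw [(hd w hw).deriv]
          have hw0 : 0 ≤ w := (Real.sqrt_nonneg _).trans hw.1.le
          refine le_trans ?_ ((hC' w ⟨hw0, hw.2.le.trans (hz.2.trans hrM)⟩).trans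
            (le_max_left _ _))
          have h2 : levelProfile b g k' w ≤ levelProfile b g M w := by
            rcases hk'.eq_or_lt with rfl | hlt
            · exact le_rfl
            · exact (levelProfile_lt hg b hlt hw.1.le).le
          have h3 : 0 ≤ levelProfile b g k' w := h'.nonneg_of_le hw.1.le
          have h4 : b * levelProfile b g k' w ≤ |b| * levelProfile b g M w :=
            mul_le_mul (le_abs_self b) h2 h3 (abs_nonneg b)
          linarith
      have h2 : max C 0 * (z - √(-k')) ≤ max C 0 * (√(-k) - √(-k')) := by
        gcongr
        exact hz.2
      have h3 : 0 ≤ max C 0 * (√(-k) - √(-k')) := mul_nonneg hCpos (by linarith)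
      rw [hs'] at h1
      refine abs_le_of_sq_le_sq ?_ (by positivity)
      have h4 := Real.sq_sqrt h3
      have h5 := mul_nonneg (Real.sqrt_nonneg k')
        (Real.sqrt_nonneg (max C 0 * (√(-k) - √(-k'))))
      nlinarith
    rw [hsk0, sub_zero]
    rcases le_total √(-k) x with hx | hx
    · refine (hcontr hx).trans ?_
      rw [hsk0, zero_sub, abs_neg]
      exact key _ ⟨hr, le_rfl⟩
    · have e1 : extProfile b g k x = 0 := by
        rw [extProfile, max_eq_right hx, hs, hsk0]
      rw [e1, zero_sub, abs_neg]
      exact key _ ⟨le_max_right _ _, max_le hx hr⟩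

theorem continuous_uncurry_extProfile (hg : IsForce g) (b : ℝ) :
    Continuous fun p : ℝ × ℝ => extProfile b g p.1 p.2 := by
  rw [continuous_iff_continuousAt]
  rintro ⟨k₀, x₀⟩
  obtain ⟨C, -, hC⟩ := extProfile_estimate hg b (M := |k₀| + 1) (by positivity)
  have hbd : ∀ᶠ p : ℝ × ℝ in 𝓝 (k₀, x₀), |extProfile b g p.1 p.2 - extProfile b g k₀ x₀| ≤
      |√p.1 - √k₀| + √(C * |√(-p.1) - √(-k₀)|) +
        |extProfile b g k₀ p.2 - extProfile b g k₀ x₀| := by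
    have hev : ∀ᶠ p : ℝ × ℝ in 𝓝 (k₀, x₀), p.1 ∈ Ioo (k₀ - 1) (k₀ + 1) :=
      continuous_fst.continuousAt.eventually (Ioo_mem_nhds (by simp) (by simp))
    filter_upwards [hev] with p hp
    have h1 : |extProfile b g p.1 p.2 - extProfile b g k₀ p.2| ≤
        |√p.1 - √k₀| + √(C * |√(-p.1) - √(-k₀)|) := by
      have ha := neg_abs_le k₀
      have hb := le_abs_self k₀
      rcases lt_trichotomy p.1 k₀ with h | h | h
      · refine (hC p.1 k₀ (by linarith [hp.1]) h (by linarith) p.2).trans ?_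
        rw [abs_sub_comm √p.1, abs_of_nonneg (sub_nonneg.2 (Real.sqrt_le_sqrt h.le)),
          abs_of_nonneg (sub_nonneg.2 (Real.sqrt_le_sqrt (neg_le_neg h.le)))]
      · rw [h]
        simp
      · rw [abs_sub_comm]
        refine (hC k₀ p.1 (by linarith) h (by linarith [hp.2]) p.2).trans ?_
        rw [abs_of_nonneg (sub_nonneg.2 (Real.sqrt_le_sqrt h.le)), abs_sub_comm √(-p.1),
          abs_of_nonneg (sub_nonneg.2 (Real.sqrt_le_sqrt (neg_le_neg h.le)))]
    calc _ ≤ |extProfile b g p.1 p.2 - extProfile b g k₀ p.2| + _ := abs_sub_le _ _ _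
      _ ≤ _ := by gcongr
  rw [ContinuousAt, tendsto_iff_dist_tendsto_zero]
  refine squeeze_zero' (Eventually.of_forall fun _ => dist_nonneg) hbd ?_
  have hcont : Continuous fun p : ℝ × ℝ => |√p.1 - √k₀| + √(C * |√(-p.1) - √(-k₀)|) +
      |extProfile b g k₀ p.2 - extProfile b g k₀ x₀| := by
    have := continuous_extProfile hg b k₀
    fun_prop
  simpa using hcont.tendsto (k₀, x₀)

/-! ### The straightening homeomorphism. -/

/-- The quadrant map: it takes the hyperbolas `η² - x² = k` to the profiles. -/
noncomputable def quadrantMap (b : ℝ) (g : ℝ → ℝ) (x η : ℝ) : ℝ :=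
  extProfile b g (η ^ 2 - x ^ 2) x

theorem continuous_quadrantMap (hg : IsForce g) (b : ℝ) :
    Continuous fun p : ℝ × ℝ => quadrantMap b g p.1 p.2 :=
  (continuous_uncurry_extProfile hg b).comp
    (f := fun p : ℝ × ℝ => (p.2 ^ 2 - p.1 ^ 2, p.1)) (by fun_prop)

theorem sqrt_neg_level_le {x : ℝ} (hx : 0 ≤ x) (η : ℝ) : √(-(η ^ 2 - x ^ 2)) ≤ x :=
  Real.sqrt_le_iff.2 ⟨hx, by nlinarith [sq_nonneg η]⟩

theorem quadrantMap_eq {x : ℝ} (hx : 0 ≤ x) (η : ℝ) :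
    quadrantMap b g x η = levelProfile b g (η ^ 2 - x ^ 2) x :=
  extProfile_of_le (sqrt_neg_level_le hx η)

theorem quadrantMap_zero_left (hg : IsForce g) (b : ℝ) {η : ℝ} (hη : 0 ≤ η) :
    quadrantMap b g 0 η = η := by
  have h := (levelProfile_spec hg b (η ^ 2)).2
  rw [Real.sqrt_eq_zero_of_nonpos (by nlinarith [sq_nonneg η]), Real.sqrt_sq hη] at h
  rw [quadrantMap_eq le_rfl]
  simpa using h

theorem quadrantMap_zero_right (hg : IsForce g) (b : ℝ) {x : ℝ} (hx : 0 ≤ x) :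
    quadrantMap b g x 0 = 0 := by
  have h := (levelProfile_spec hg b (-x ^ 2)).2
  rw [neg_neg, Real.sqrt_sq hx, Real.sqrt_eq_zero_of_nonpos (by nlinarith [sq_nonneg x])] at h
  rw [quadrantMap_eq hx]
  simpa using h

theorem strictMonoOn_quadrantMap (hg : IsForce g) (b : ℝ) {x : ℝ} (hx : 0 ≤ x) :
    StrictMonoOn (quadrantMap b g x) (Ici 0) := by
  intro η hη η' _ hlt
  rw [quadrantMap_eq hx, quadrantMap_eq hx]
  refine levelProfile_lt hg b ?_ (sqrt_neg_level_le hx η)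
  have : 0 ≤ η := hη
  gcongr

theorem exists_le_quadrantMap (hg : IsForce g) (b : ℝ) {x : ℝ} (hx : 0 ≤ x) (M : ℝ) :
    ∃ η, 0 ≤ η ∧ M ≤ quadrantMap b g x η := by
  -- The level is then (|M| + |b|x)²: the profile starts over 0 at height |M| + |b|x, and since its
  -- slope is at least -|b| its height at x is still at least |M|.
  refine ⟨√(x ^ 2 + (|M| + |b| * x) ^ 2), Real.sqrt_nonneg _, ?_⟩
  have hk : √(x ^ 2 + (|M| + |b| * x) ^ 2) ^ 2 - x ^ 2 = (|M| + |b| * x) ^ 2 := by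
    rw [Real.sq_sqrt (by positivity)]
    ring
  rw [quadrantMap_eq hx, hk]
  obtain ⟨h, hs⟩ := levelProfile_spec hg b ((|M| + |b| * x) ^ 2)
  rw [Real.sqrt_eq_zero_of_nonpos (by rw [neg_nonpos]; positivity)] at h hs
  rw [Real.sqrt_sq (by positivity)] at hs
  have h1 : -|b| * (x - 0) ≤ levelProfile b g ((|M| + |b| * x) ^ 2) x -
      levelProfile b g ((|M| + |b| * x) ^ 2) 0 := by
    refine Convex.mul_sub_le_image_sub_of_le_deriv (convex_Icc 0 x)
      (h.continuousOn.mono Icc_subset_Ici_self) ?_ ?_ _ ⟨le_rfl, hx⟩ _ ⟨hx, le_rfl⟩ hx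
    · rw [interior_Icc]
      exact fun w hw => (h.hasDerivAt w hw.1).differentiableAt.differentiableWithinAt
    · rw [interior_Icc]
      intro w hw
      rw [(h.hasDerivAt w hw.1).deriv]
      have := div_nonneg (hg.nonneg w) (h.pos w hw.1).le
      linarith [neg_abs_le b]
  rw [hs] at h1
  linarith [le_abs_self M]

/-- The second component of the homeomorphism that takes the hyperbolas `η² - x² = k` to the
orbits of the field; the quadrants are glued along the axes. -/
noncomputable def planeMap (a : ℝ) (g : ℝ → ℝ) (x η : ℝ) : ℝ :=
  quadrantMap a g (max x 0) (max η 0) - quadrantMap a g (max (-x) 0) (max (-η) 0)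
    - quadrantMap (-a) g (max x 0) (max (-η) 0) + quadrantMap (-a) g (max (-x) 0) (max η 0) - η

theorem continuous_planeMap (hg : IsForce g) (a : ℝ) :
    Continuous fun p : ℝ × ℝ => planeMap a g p.1 p.2 := by
  have h1 := continuous_quadrantMap hg a
  have h2 := continuous_quadrantMap hg (-a)
  unfold planeMap
  refine ((((h1.comp (f := fun p : ℝ × ℝ => (max p.1 0, max p.2 0)) ?_).sub
    (h1.comp (f := fun p : ℝ × ℝ => (max (-p.1) 0, max (-p.2) 0)) ?_)).sub
    (h2.comp (f := fun p : ℝ × ℝ => (max p.1 0, max (-p.2) 0)) ?_)).add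
    (h2.comp (f := fun p : ℝ × ℝ => (max (-p.1) 0, max p.2 0)) ?_)).sub ?_
  all_goals fun_prop

theorem planeMap_neg_neg (a : ℝ) (g : ℝ → ℝ) (x η : ℝ) :
    planeMap a g (-x) (-η) = - planeMap a g x η := by
  simp only [planeMap, neg_neg]
  ring

variable {a x η : ℝ}

/-- The two terms containing max (-x) 0 = 0 are evaluated on the y-axis, where every quadrant map is
the identity. They add up to η, which the final -η in `planeMap` removes. -/
theorem planeMap_of_nonneg (hg : IsForce g) (hx : 0 ≤ x) :
    planeMap a g x η = quadrantMap a g x (max η 0) - quadrantMap (-a) g x (max (-η) 0) := by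
  rw [planeMap, max_eq_left hx, max_eq_right (neg_nonpos.2 hx),
    quadrantMap_zero_left hg _ (le_max_right _ _), quadrantMap_zero_left hg _ (le_max_right _ _)]
  have : max η 0 - max (-η) 0 = η := by
    rcases le_total 0 η with h | h
    · rw [max_eq_left h, max_eq_right (by linarith)]; ring
    · rw [max_eq_right h, max_eq_left (by linarith)]; ring
  linarith

theorem planeMap_pos_pos (hg : IsForce g) (hx : 0 ≤ x) (hη : 0 ≤ η) :
    planeMap a g x η = quadrantMap a g x η := by
  rw [planeMap_of_nonneg hg hx, max_eq_left hη, max_eq_right (by linarith),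
    quadrantMap_zero_right hg _ hx, sub_zero]

theorem planeMap_pos_neg (hg : IsForce g) (hx : 0 ≤ x) (hη : 0 ≤ η) :
    planeMap a g x (-η) = -quadrantMap (-a) g x η := by
  rw [planeMap_of_nonneg hg hx, neg_neg, max_eq_left hη, max_eq_right (by linarith),
    quadrantMap_zero_right hg _ hx, zero_sub]

theorem planeMap_zero_right (hg : IsForce g) (a x : ℝ) : planeMap a g x 0 = 0 := by
  rcases le_total 0 x with hx | hx
  · rw [planeMap_pos_pos hg hx le_rfl, quadrantMap_zero_right hg _ hx]
  · have := planeMap_neg_neg a g (-x) 0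
    rwa [neg_neg, neg_zero, planeMap_pos_pos hg (neg_nonneg.2 hx) le_rfl,
      quadrantMap_zero_right hg _ (neg_nonneg.2 hx), neg_zero] at this

theorem strictMono_planeMap (hg : IsForce g) (a x : ℝ) : StrictMono (planeMap a g x) := by
  have main : ∀ x, 0 ≤ x → StrictMono (planeMap a g x) := by
    intro x hx η η' h
    rw [planeMap_of_nonneg hg hx, planeMap_of_nonneg hg hx]
    have h1 := strictMonoOn_quadrantMap hg a hx
    have h2 := strictMonoOn_quadrantMap hg (-a) hx
    have m1 : ∀ t : ℝ, max t 0 ∈ Ici (0 : ℝ) := fun t => mem_Ici.2 (le_max_right _ _)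
    have l1 := h1.monotoneOn (m1 η) (m1 η') (max_le_max h.le le_rfl)
    have l2 := h2.monotoneOn (m1 (-η')) (m1 (-η)) (max_le_max (neg_le_neg h.le) le_rfl)
    rcases lt_or_ge 0 η' with h0 | h0
    · have := h1 (m1 η) (m1 η') (by rw [max_eq_left h0.le]; exact max_lt h h0)
      linarith
    · have := h2 (m1 (-η')) (m1 (-η)) (by
        rw [max_eq_left (by linarith : 0 ≤ -η'), max_eq_left (by linarith : 0 ≤ -η)]
        linarith)
      linarith
  rcases le_total 0 x with hx | hx
  · exact main x hx
  · intro η η' h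
    have := main (-x) (by linarith) (neg_lt_neg h)
    rw [planeMap_neg_neg, planeMap_neg_neg] at this
    linarith

theorem surjective_planeMap (hg : IsForce g) (a x : ℝ) : Function.Surjective (planeMap a g x) := by
  have hc : ∀ x, Continuous (planeMap a g x) := fun x =>
    (continuous_planeMap hg a).comp (f := fun η => (x, η)) (by fun_prop)
  have main : ∀ x, 0 ≤ x → Function.Surjective (planeMap a g x) := by
    intro x hx c
    obtain ⟨η₁, h₁, hc₁⟩ := exists_le_quadrantMap hg a hx c
    obtain ⟨η₂, h₂, hc₂⟩ := exists_le_quadrantMap hg (-a) hx (-c)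
    refine mem_range_of_exists_le_of_exists_ge (hc x) ⟨-η₂, ?_⟩ ⟨η₁, ?_⟩
    · rw [planeMap_pos_neg hg hx h₂]
      linarith
    · rwa [planeMap_pos_pos hg hx h₁]
  rcases le_total 0 x with hx | hx
  · exact main x hx
  · intro c
    obtain ⟨η, hη⟩ := main (-x) (by linarith) (-c)
    refine ⟨-η, ?_⟩
    have := planeMap_neg_neg a g (-x) η
    rw [neg_neg] at this
    rw [this, hη, neg_neg]

/-- A fiberwise increasing continuous bijection of the plane is a homeomorphism. -/
noncomputable def fiberHomeomorph (f : ℝ → ℝ → ℝ) (hf : Continuous fun p : ℝ × ℝ => f p.1 p.2)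
    (hmono : ∀ x, StrictMono (f x)) (hsurj : ∀ x, Function.Surjective (f x)) : Plane ≃ₜ Plane where
  toFun p := (p.1, f p.1 p.2)
  invFun p := (p.1, ((hmono p.1).orderIsoOfSurjective (f p.1) (hsurj p.1)).symm p.2)
  left_inv p := Prod.ext rfl
    (((hmono p.1).orderIsoOfSurjective (f p.1) (hsurj p.1)).symm_apply_apply p.2)
  right_inv p := Prod.ext rfl
    (((hmono p.1).orderIsoOfSurjective (f p.1) (hsurj p.1)).apply_symm_apply p.2)
  continuous_toFun := continuous_fst.prodMk hf
  continuous_invFun := by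
    refine continuous_fst.prodMk (continuous_iff_continuousAt.2 fun p₀ => ?_)
    -- The sets where the inverse exceeds m, or is below m, are the two sides of the graph of the
    -- continuous function x ↦ f x m, hence open.
    have hlt : ∀ (p : ℝ × ℝ) (m : ℝ),
        m < ((hmono p.1).orderIsoOfSurjective (f p.1) (hsurj p.1)).symm p.2 ↔ f p.1 m < p.2 :=
      fun p m => OrderIso.lt_symm_apply _
    have hgt : ∀ (p : ℝ × ℝ) (m : ℝ),
        ((hmono p.1).orderIsoOfSurjective (f p.1) (hsurj p.1)).symm p.2 < m ↔ p.2 < f p.1 m :=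
      fun p m => OrderIso.symm_apply_lt _
    have hc : ∀ m : ℝ, Continuous fun p : ℝ × ℝ => f p.1 m := fun m =>
      hf.comp (f := fun p : ℝ × ℝ => (p.1, m)) (by fun_prop)
    refine tendsto_order.2 ⟨fun m hm => ?_, fun m hm => ?_⟩
    · filter_upwards [(hc m).continuousAt.eventually_lt continuous_snd.continuousAt
        ((hlt p₀ m).1 hm)] with p hp
      exact (hlt p m).2 hp
    · filter_upwards [continuous_snd.continuousAt.eventually_lt (hc m).continuousAt
        ((hgt p₀ m).1 hm)] with p hp
      exact (hgt p m).2 hp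

/-- The homeomorphism that takes the orbits of the linear saddle to those of the field. -/
noncomputable def straightening {g : ℝ → ℝ} (hg : IsForce g) (a : ℝ) : Plane ≃ₜ Plane :=
  fiberHomeomorph (planeMap a g) (continuous_planeMap hg a) (strictMono_planeMap hg a)
    (surjective_planeMap hg a)

theorem straightening_apply (hg : IsForce g) (a : ℝ) (p : Plane) :
    straightening hg a p = (p.1, planeMap a g p.1 p.2) := rfl

end PhasePortrait

/-! ### The image of a saddle orbit under the straightening. -/

namespace PhasePortrait

open Set MeasureTheory Filter Topology

variable {g : ℝ → ℝ} {a : ℝ}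

/-- The field `y ∂x + (a y + sign(x) g(|x|)) ∂y`. -/
noncomputable def forcedField (a : ℝ) (g : ℝ → ℝ) (p : Plane) : Plane :=
  (p.2, a * p.2 + Real.sign p.1 * g |p.1|)

theorem forcedField_eq_zero_iff (hg : IsForce g) {p : Plane} : forcedField a g p = 0 ↔ p = 0 := by
  constructor
  · intro h
    have h1 : p.2 = 0 := congrArg Prod.fst h
    have h2 : a * p.2 + Real.sign p.1 * g |p.1| = 0 := congrArg Prod.snd h
    rw [h1, mul_zero, zero_add] at h2
    refine Prod.ext ?_ h1
    by_contra h0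
    rcases mul_eq_zero.1 h2 with h3 | h3
    · exact h0 (Real.sign_eq_zero_iff.1 h3)
    · exact (hg.pos _ (abs_pos.2 h0)).ne' h3
  · rintro rfl
    simp [forcedField]

theorem exists_unit_mul_pos {x : ℝ} (hx : x ≠ 0) : ∃ σ : ℝ, (σ = 1 ∨ σ = -1) ∧ 0 < σ * x := by
  rcases lt_or_gt_of_ne hx with h | h
  · exact ⟨-1, Or.inr rfl, by linarith⟩
  · exact ⟨1, Or.inl rfl, by linarith⟩

theorem abs_eq_unit_mul {σ x : ℝ} (hσ : σ = 1 ∨ σ = -1) (h : 0 < σ * x) : |x| = σ * x := by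
  rcases hσ with rfl | rfl
  · rw [one_mul] at h ⊢
    exact abs_of_pos h
  · rw [neg_one_mul] at h ⊢
    exact abs_of_neg (by linarith)

theorem sign_eq_unit {σ x : ℝ} (hσ : σ = 1 ∨ σ = -1) (h : 0 < σ * x) : Real.sign x = σ := by
  rcases hσ with rfl | rfl
  · exact Real.sign_of_pos (by linarith)
  · exact Real.sign_of_neg (by linarith)

theorem measurable_realSign : Measurable Real.sign := by
  unfold Real.sign
  exact Measurable.ite measurableSet_Iio measurable_const
    (Measurable.ite measurableSet_Ioi measurable_const measurable_const)

/-- The signs σ and ε encode the quadrant, so that one computation serves all four. The coefficient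
is σεa because a reflection in either axis changes the sign of a. -/
theorem planeMap_eq (hg : IsForce g) (a : ℝ) {σ ε x η : ℝ} (hσ : σ = 1 ∨ σ = -1)
    (hε : ε = 1 ∨ ε = -1) (hx : 0 ≤ σ * x) (hη : 0 ≤ ε * η) :
    planeMap a g x η = ε * levelProfile (σ * ε * a) g (η ^ 2 - x ^ 2) (σ * x) := by
  have key : planeMap a g (σ * (σ * x)) (ε * (ε * η)) =
      ε * quadrantMap (σ * ε * a) g (σ * x) (ε * η) := by
    rcases hσ with rfl | rfl <;> rcases hε with rfl | rfl
    · rw [one_mul (1 * x), one_mul (1 * η), planeMap_pos_pos hg hx hη]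
      simp
    · rw [one_mul (1 * x), neg_one_mul (-1 * η), planeMap_pos_neg hg hx hη]
      simp
    · rw [neg_one_mul (-1 * x), one_mul (1 * η), ← neg_neg (1 * η), planeMap_neg_neg,
        planeMap_pos_neg hg hx hη]
      simp
    · rw [neg_one_mul (-1 * x), neg_one_mul (-1 * η), planeMap_neg_neg, planeMap_pos_pos hg hx hη]
      simp
  have s1 : σ * σ = 1 := by rcases hσ with rfl | rfl <;> norm_num
  have s2 : ε * ε = 1 := by rcases hε with rfl | rfl <;> norm_num
  rw [← mul_assoc, ← mul_assoc, s1, s2, one_mul, one_mul, quadrantMap_eq hx] at key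
  rw [key, mul_pow, mul_pow, sq σ, sq ε, s1, s2, one_mul, one_mul]

/-- The motion x is arbitrary, so this serves both for the saddle flow and for an unknown trajectory
that is compared with a profile. -/
theorem hasDerivAt_branch (hg : IsForce g) (a : ℝ) {σ ε k : ℝ} (hσ : σ = 1 ∨ σ = -1)
    (hε : ε = 1 ∨ ε = -1) {x : ℝ → ℝ} {x' t : ℝ} (hx : HasDerivAt x x' t)
    (hk : √(-k) < σ * x t) :
    HasDerivAt (fun t => ε * levelProfile (σ * ε * a) g k (σ * x t))
      (x' * (a + σ * g (σ * x t) / (ε * levelProfile (σ * ε * a) g k (σ * x t)))) t := by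
  have hS := (levelProfile_spec hg (σ * ε * a) k).1
  have hd : HasDerivAt (fun t => σ * x t) (σ * x') t := hx.const_mul σ
  have h := ((hS.hasDerivAt _ hk).comp t hd).const_mul ε
  refine h.congr_deriv ?_
  have hp := hS.pos _ hk
  have s1 : σ * σ = 1 := by rcases hσ with rfl | rfl <;> norm_num
  have s2 : ε * ε = 1 := by rcases hε with rfl | rfl <;> norm_num
  have s0 : ε ≠ 0 := fun h => by simp [h] at s2
  field_simp
  have s3 : ε ^ 2 = 1 := by rw [sq, s2]
  have s4 : σ ^ 2 = 1 := by rw [sq, s1]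
  rw [s3]
  linear_combination (x' * a * ε) * s4

theorem planeMap_eq_zero_iff (hg : IsForce g) (a x η : ℝ) : planeMap a g x η = 0 ↔ η = 0 := by
  have := (strictMono_planeMap hg a x).injective.eq_iff (a := η) (b := 0)
  rwa [planeMap_zero_right hg] at this

theorem unit_mul_planeMap_pos (hg : IsForce g) (a x : ℝ) {ε η : ℝ} (hε : ε = 1 ∨ ε = -1)
    (hη : 0 < ε * η) : 0 < ε * planeMap a g x η := by
  rcases hε with rfl | rfl
  · rw [one_mul] at hη ⊢
    rw [← planeMap_zero_right hg a x]
    exact strictMono_planeMap hg a x hη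
  · rw [neg_one_mul] at hη ⊢
    have : planeMap a g x η < planeMap a g x 0 := strictMono_planeMap hg a x (by linarith)
    rw [planeMap_zero_right hg] at this
    linarith

/-- The flow of the linear saddle. -/
noncomputable def saddleFlow (p : Plane) (s : ℝ) : Plane :=
  (p.1 * Real.cosh s + p.2 * Real.sinh s, p.1 * Real.sinh s + p.2 * Real.cosh s)

theorem hasDerivAt_saddleFlow_fst (p : Plane) (s : ℝ) :
    HasDerivAt (fun s => (saddleFlow p s).1) (saddleFlow p s).2 s := by
  have := ((Real.hasDerivAt_cosh s).const_mul p.1).add ((Real.hasDerivAt_sinh s).const_mul p.2)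
  exact this

theorem hasDerivAt_saddleFlow_snd (p : Plane) (s : ℝ) :
    HasDerivAt (fun s => (saddleFlow p s).2) (saddleFlow p s).1 s := by
  have := ((Real.hasDerivAt_sinh s).const_mul p.1).add ((Real.hasDerivAt_cosh s).const_mul p.2)
  exact this

theorem continuous_saddleFlow_fst (p : Plane) : Continuous fun s => (saddleFlow p s).1 :=
  continuous_iff_continuousAt.2 fun s => (hasDerivAt_saddleFlow_fst p s).continuousAt

theorem continuous_saddleFlow_snd (p : Plane) : Continuous fun s => (saddleFlow p s).2 :=
  continuous_iff_continuousAt.2 fun s => (hasDerivAt_saddleFlow_snd p s).continuousAt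

theorem continuous_saddleFlow (p : Plane) : Continuous (saddleFlow p) :=
  (continuous_saddleFlow_fst p).prodMk (continuous_saddleFlow_snd p)

theorem saddleFlow_zero (p : Plane) : saddleFlow p 0 = p := by
  simp [saddleFlow]

theorem saddleFlow_level (p : Plane) (s : ℝ) :
    (saddleFlow p s).2 ^ 2 - (saddleFlow p s).1 ^ 2 = p.2 ^ 2 - p.1 ^ 2 := by
  simp only [saddleFlow]
  linear_combination (p.2 ^ 2 - p.1 ^ 2) * Real.cosh_sq_sub_sinh_sq s

theorem saddleFlow_ne_zero {p : Plane} (hp : p ≠ 0) (s : ℝ) : saddleFlow p s ≠ 0 := by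
  intro h
  have h1 : (saddleFlow p s).1 = 0 := congrArg Prod.fst h
  have h2 : (saddleFlow p s).2 = 0 := congrArg Prod.snd h
  simp only [saddleFlow] at h1 h2
  have hc := Real.cosh_sq_sub_sinh_sq s
  refine hp (Prod.ext ?_ ?_)
  · simp only [Prod.fst_zero]
    linear_combination Real.cosh s * h1 - Real.sinh s * h2 - p.1 * hc
  · simp only [Prod.snd_zero]
    linear_combination Real.cosh s * h2 - Real.sinh s * h1 - p.2 * hc

/-- The derivative of xη is x² + η². Consequently an orbit meets the union of the axes at most once.
-/
theorem strictMono_saddleFlow_mul {p : Plane} (hp : p ≠ 0) :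
    StrictMono fun s => (saddleFlow p s).1 * (saddleFlow p s).2 := by
  refine strictMono_of_hasDerivAt_pos
    (fun s => (hasDerivAt_saddleFlow_fst p s).mul (hasDerivAt_saddleFlow_snd p s)) fun s => ?_
  have h := saddleFlow_ne_zero hp s
  by_contra! hle
  refine h (Prod.ext ?_ ?_)
  · simp only [Prod.fst_zero]
    nlinarith [sq_nonneg (saddleFlow p s).1, sq_nonneg (saddleFlow p s).2]
  · simp only [Prod.snd_zero]
    nlinarith [sq_nonneg (saddleFlow p s).1, sq_nonneg (saddleFlow p s).2]

theorem hasDerivAt_planeMap_saddleFlow (hg : IsForce g) (a : ℝ) (p : Plane) {s : ℝ}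
    (h1 : (saddleFlow p s).1 ≠ 0) (h2 : (saddleFlow p s).2 ≠ 0) :
    HasDerivAt (fun s => planeMap a g (saddleFlow p s).1 (saddleFlow p s).2)
      ((saddleFlow p s).2 * (a + Real.sign (saddleFlow p s).1 * g |(saddleFlow p s).1| /
        planeMap a g (saddleFlow p s).1 (saddleFlow p s).2)) s := by
  obtain ⟨σ, hσ, hx⟩ := exists_unit_mul_pos h1
  obtain ⟨ε, hε, hη⟩ := exists_unit_mul_pos h2
  have hk : √(-(p.2 ^ 2 - p.1 ^ 2)) < σ * (saddleFlow p s).1 := by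
    rw [Real.sqrt_lt' hx, ← saddleFlow_level p s, ← abs_eq_unit_mul hσ hx, sq_abs]
    have : 0 < (saddleFlow p s).2 ^ 2 := by positivity
    linarith
  have hd := hasDerivAt_branch hg a hσ hε (hasDerivAt_saddleFlow_fst p s) hk
  have heq : ∀ s, 0 < σ * (saddleFlow p s).1 → 0 < ε * (saddleFlow p s).2 →
      planeMap a g (saddleFlow p s).1 (saddleFlow p s).2 =
      ε * levelProfile (σ * ε * a) g (p.2 ^ 2 - p.1 ^ 2) (σ * (saddleFlow p s).1) := by
    intro s hx hη
    rw [planeMap_eq hg a hσ hε hx.le hη.le, saddleFlow_level]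
  rw [abs_eq_unit_mul hσ hx, sign_eq_unit hσ hx, heq s hx hη]
  refine hd.congr_of_eventuallyEq ?_
  filter_upwards [(continuous_const.mul (continuous_saddleFlow_fst p)).continuousAt.eventually_const_lt
    hx, (continuous_const.mul (continuous_saddleFlow_snd p)).continuousAt.eventually_const_lt hη]
    with s hx hη
  exact heq s hx hη

/-! ### The change of time. -/

/-- The time of the field that elapses per unit of time of the linear saddle. -/
noncomputable def timeRatio (a : ℝ) (g : ℝ → ℝ) (q : Plane) : ℝ :=
  if q.2 = 0 then √(|q.1| / g |q.1|) else q.2 / planeMap a g q.1 q.2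

theorem timeRatio_pos (hg : IsForce g) (a : ℝ) {q : Plane} (hq : q ≠ 0) : 0 < timeRatio a g q := by
  rw [timeRatio]
  split_ifs with h
  · have h1 : q.1 ≠ 0 := fun h1 => hq (Prod.ext h1 h)
    have := hg.pos _ (abs_pos.2 h1)
    positivity
  · obtain ⟨ε, hε, hη⟩ := exists_unit_mul_pos h
    have h2 := unit_mul_planeMap_pos hg a q.1 hε hη
    have h3 := div_pos hη h2
    have s0 : ε ≠ 0 := by rcases hε with rfl | rfl <;> norm_num
    rwa [mul_div_mul_left _ _ s0] at h3

theorem continuousAt_timeRatio_saddleFlow_of_ne (hg : IsForce g) (a : ℝ) (p : Plane) {s : ℝ}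
    (h : (saddleFlow p s).2 ≠ 0) : ContinuousAt (fun s => timeRatio a g (saddleFlow p s)) s := by
  have hc : Continuous fun s => planeMap a g (saddleFlow p s).1 (saddleFlow p s).2 :=
    (continuous_planeMap hg a).comp (continuous_saddleFlow p)
  have := (continuous_saddleFlow_snd p).continuousAt.div hc.continuousAt
    (mt (planeMap_eq_zero_iff hg a (saddleFlow p s).1 _).1 h)
  refine this.congr ?_
  filter_upwards [(continuous_saddleFlow_snd p).continuousAt.eventually_ne h] with s hs
  rw [timeRatio, if_neg hs]
  rfl

/-- At a crossing of the x-axis, η/y has the form 0/0. L'Hôpital is applied to η²/y²: the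
derivatives 2ηx and 2η(a y + σg) share the factor 2η, and the remaining quotient tends to
|x|/g(|x|). This explains the square root in `timeRatio`. -/
theorem continuousAt_timeRatio_saddleFlow_of_eq (hg : IsForce g) (a : ℝ) {p : Plane} (hp : p ≠ 0)
    {s : ℝ} (h : (saddleFlow p s).2 = 0) :
    ContinuousAt (fun s => timeRatio a g (saddleFlow p s)) s := by
  have hx0 : (saddleFlow p s).1 ≠ 0 := fun h1 => saddleFlow_ne_zero hp s (Prod.ext h1 h)
  obtain ⟨σ, hσ, hσx⟩ := exists_unit_mul_pos hx0
  have hc1 := continuous_saddleFlow_fst p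
  have hc2 := continuous_saddleFlow_snd p
  have hc : Continuous fun s => planeMap a g (saddleFlow p s).1 (saddleFlow p s).2 :=
    (continuous_planeMap hg a).comp (continuous_saddleFlow p)
  have hx : ∀ᶠ t in 𝓝[≠] s, 0 < σ * (saddleFlow p t).1 :=
    ((continuous_const.mul hc1).continuousAt.eventually_const_lt hσx).filter_mono
      nhdsWithin_le_nhds
  have hη : ∀ᶠ t in 𝓝[≠] s, (saddleFlow p t).2 ≠ 0 :=
    (hasDerivAt_saddleFlow_snd p s).eventually_ne hx0
  have hcD : Continuous fun t => a * planeMap a g (saddleFlow p t).1 (saddleFlow p t).2 +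
      σ * g (σ * (saddleFlow p t).1) := by
    have := hg.continuous
    fun_prop
  have hs0 : planeMap a g (saddleFlow p s).1 (saddleFlow p s).2 = 0 :=
    (planeMap_eq_zero_iff hg a _ _).2 h
  have hσ0 : σ ≠ 0 := fun h => by simp [h] at hσx
  have hgs : 0 < g (σ * (saddleFlow p s).1) := hg.pos _ hσx
  have hDs : a * planeMap a g (saddleFlow p s).1 (saddleFlow p s).2 +
      σ * g (σ * (saddleFlow p s).1) ≠ 0 := by
    rw [hs0, mul_zero, zero_add]
    exact mul_ne_zero hσ0 hgs.ne'
  have hD : ∀ᶠ t in 𝓝[≠] s, a * planeMap a g (saddleFlow p t).1 (saddleFlow p t).2 +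
      σ * g (σ * (saddleFlow p t).1) ≠ 0 :=
    (hcD.continuousAt.eventually_ne hDs).filter_mono nhdsWithin_le_nhds
  have hlim : Tendsto (fun t => (saddleFlow p t).2 ^ 2 /
      planeMap a g (saddleFlow p t).1 (saddleFlow p t).2 ^ 2) (𝓝[≠] s)
      (𝓝 (|(saddleFlow p s).1| / g |(saddleFlow p s).1|)) := by
    refine HasDerivAt.lhopital_zero_nhdsNE
      (f' := fun t => 2 * (saddleFlow p t).2 * (saddleFlow p t).1)
      (g' := fun t => 2 * (saddleFlow p t).2 *
        (a * planeMap a g (saddleFlow p t).1 (saddleFlow p t).2 + σ * g (σ * (saddleFlow p t).1)))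
      ?_ ?_ ?_ ?_ ?_ ?_
    · refine Eventually.of_forall fun t => ?_
      refine ((hasDerivAt_saddleFlow_snd p t).pow 2).congr_deriv ?_
      simp
    · filter_upwards [hx, hη] with t htx htη
      have := (hasDerivAt_planeMap_saddleFlow hg a p (fun h0 => by simp [h0] at htx) htη).pow 2
      refine this.congr_deriv ?_
      rw [abs_eq_unit_mul hσ htx, sign_eq_unit hσ htx]
      have := mt (planeMap_eq_zero_iff hg a (saddleFlow p t).1 _).1 htη
      simp only [Nat.cast_ofNat, Nat.add_one_sub_one, pow_one]
      field_simp
    · filter_upwards [hη, hD] with t h1 h2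
      exact mul_ne_zero (mul_ne_zero two_ne_zero h1) h2
    · have : Tendsto (fun t => (saddleFlow p t).2 ^ 2) (𝓝 s) _ := (hc2.pow 2).tendsto s
      simpa [h] using this.mono_left (nhdsWithin_le_nhds (s := {s}ᶜ))
    · have : Tendsto (fun t => planeMap a g (saddleFlow p t).1 (saddleFlow p t).2 ^ 2) (𝓝 s) _ :=
        (hc.pow 2).tendsto s
      simpa [hs0] using this.mono_left (nhdsWithin_le_nhds (s := {s}ᶜ))
    · have := (hc1.continuousAt (x := s)).div hcD.continuousAt hDs
      have h3 := this.tendsto.mono_left (nhdsWithin_le_nhds (s := {s}ᶜ))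
      simp only [Pi.div_apply, hs0, mul_zero, zero_add] at h3
      have e : (saddleFlow p s).1 / (σ * g (σ * (saddleFlow p s).1)) =
          |(saddleFlow p s).1| / g |(saddleFlow p s).1| := by
        rw [abs_eq_unit_mul hσ hσx]
        have s1 : σ ^ 2 = 1 := by rcases hσ with rfl | rfl <;> norm_num
        field_simp
        rw [s1]
      rw [e] at h3
      refine h3.congr' ?_
      filter_upwards [hη] with t ht
      rw [mul_div_mul_left _ _ (mul_ne_zero two_ne_zero ht)]
      rfl
  rw [continuousAt_iff_punctured_nhds]
  have h4 := (Real.continuous_sqrt.tendsto _).comp hlim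
  have e : timeRatio a g (saddleFlow p s) = √(|(saddleFlow p s).1| / g |(saddleFlow p s).1|) := by
    rw [timeRatio, if_pos h]
  rw [e]
  refine h4.congr' ?_
  filter_upwards [hη] with t ht
  have h5 := timeRatio_pos hg a (saddleFlow_ne_zero hp t)
  have h6 : timeRatio a g (saddleFlow p t) =
      (saddleFlow p t).2 / planeMap a g (saddleFlow p t).1 (saddleFlow p t).2 := by
    rw [timeRatio, if_neg ht]
  rw [Function.comp_apply, ← div_pow, ← h6, Real.sqrt_sq h5.le]

theorem continuous_timeRatio_saddleFlow (hg : IsForce g) (a : ℝ) {p : Plane} (hp : p ≠ 0) :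
    Continuous fun s => timeRatio a g (saddleFlow p s) := by
  refine continuous_iff_continuousAt.2 fun s => ?_
  by_cases h : (saddleFlow p s).2 = 0
  · exact continuousAt_timeRatio_saddleFlow_of_eq hg a hp h
  · exact continuousAt_timeRatio_saddleFlow_of_ne hg a p h

/-- The time of the field along the orbit through the image of `p`, as a function of the time of
the linear saddle. -/
noncomputable def orbitTime (a : ℝ) (g : ℝ → ℝ) (p : Plane) (t₀ s : ℝ) : ℝ :=
  t₀ + ∫ u in (0 : ℝ)..s, timeRatio a g (saddleFlow p u)

theorem orbitTime_zero (a : ℝ) (g : ℝ → ℝ) (p : Plane) (t₀ : ℝ) : orbitTime a g p t₀ 0 = t₀ := by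
  simp [orbitTime]

theorem hasDerivAt_orbitTime (hg : IsForce g) (a : ℝ) {p : Plane} (hp : p ≠ 0) (t₀ s : ℝ) :
    HasDerivAt (orbitTime a g p t₀) (timeRatio a g (saddleFlow p s)) s :=
  (((continuous_timeRatio_saddleFlow hg a hp).integral_hasStrictDerivAt 0 s).hasDerivAt).const_add t₀

theorem strictMono_orbitTime (hg : IsForce g) (a : ℝ) {p : Plane} (hp : p ≠ 0) (t₀ : ℝ) :
    StrictMono (orbitTime a g p t₀) :=
  strictMono_of_hasDerivAt_pos (hasDerivAt_orbitTime hg a hp t₀)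
    fun s => timeRatio_pos hg a (saddleFlow_ne_zero hp s)

/-- The orbit of the field through the image of `p`. -/
noncomputable def orbitCurve (hg : IsForce g) (a : ℝ) (p : Plane) (t₀ t : ℝ) : Plane :=
  straightening hg a (saddleFlow p (Function.invFun (orbitTime a g p t₀) t))

theorem orbitCurve_orbitTime (hg : IsForce g) (a : ℝ) {p : Plane} (hp : p ≠ 0) (t₀ s : ℝ) :
    orbitCurve hg a p t₀ (orbitTime a g p t₀ s) = straightening hg a (saddleFlow p s) := by
  rw [orbitCurve, Function.leftInverse_invFun (strictMono_orbitTime hg a hp t₀).injective s]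

theorem ordConnected_range_of_continuous {T : ℝ → ℝ} (hT : Continuous T) :
    (range T).OrdConnected :=
  (isPreconnected_range hT).ordConnected

theorem range_mem_nhds {T : ℝ → ℝ} (hT : Continuous T) (hm : StrictMono T) (s : ℝ) :
    range T ∈ 𝓝 (T s) :=
  mem_of_superset (Icc_mem_nhds (hm (by linarith : s - 1 < s)) (hm (by linarith : s < s + 1)))
    ((ordConnected_range_of_continuous hT).out (mem_range_self _) (mem_range_self _))

theorem continuousAt_invFun {T : ℝ → ℝ} (hT : Continuous T) (hm : StrictMono T) (s : ℝ) :
    ContinuousAt (Function.invFun T) (T s) := by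
  have hl := Function.leftInverse_invFun hm.injective
  refine StrictMonoOn.continuousAt_of_image_mem_nhds (s := range T) ?_ (range_mem_nhds hT hm s) ?_
  · rintro _ ⟨u, rfl⟩ _ ⟨v, rfl⟩ h
    rw [hl, hl]
    exact hm.lt_iff_lt.1 h
  · have : Function.invFun T '' range T = univ := by
      refine eq_univ_of_forall fun u => ⟨T u, mem_range_self u, hl u⟩
    rw [this]
    exact univ_mem

/-- Off the axes the chain rule gives the differential equation, since the factor η/y in `timeRatio`
is what turns the saddle's velocity into that of the field. The axes are met at most once, so the
fundamental theorem of calculus with a countable exceptional set gives the integrated form. The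
range of `orbitTime` need not be all of ℝ: an orbit may tend to the origin in finite time. -/
theorem isRegularTrajectory_orbitCurve (hg : IsForce g) (a : ℝ) {p : Plane} (hp : p ≠ 0)
    (t₀ : ℝ) : IsRegularTrajectory (forcedField a g) (range (orbitTime a g p t₀))
      (orbitCurve hg a p t₀) := by
  set T := orbitTime a g p t₀ with hTdef
  have hd : ∀ s, HasDerivAt T (timeRatio a g (saddleFlow p s)) s := hasDerivAt_orbitTime hg a hp t₀
  have hT : Continuous T := continuous_iff_continuousAt.2 fun s => (hd s).continuousAt
  have hm : StrictMono T := strictMono_orbitTime hg a hp t₀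
  have hl : ∀ s, Function.invFun T (T s) = s := Function.leftInverse_invFun hm.injective
  have hord := ordConnected_range_of_continuous hT
  have hinv : ∀ s, HasDerivAt (Function.invFun T) (timeRatio a g (saddleFlow p s))⁻¹ (T s) := by
    intro s
    refine HasDerivAt.of_local_left_inverse (f := T) (continuousAt_invFun hT hm s) ?_
      (timeRatio_pos hg a (saddleFlow_ne_zero hp s)).ne' ?_
    · rw [hl]
      exact hd s
    · filter_upwards [range_mem_nhds hT hm s] with t ht
      exact Function.invFun_eq ht
  have hcont : ContinuousOn (orbitCurve hg a p t₀) (range T) := by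
    rintro _ ⟨s, rfl⟩
    refine ContinuousAt.continuousWithinAt ?_
    exact ((straightening hg a).continuous.comp (continuous_saddleFlow p)).continuousAt.comp
      (continuousAt_invFun hT hm s)
  have hsub : ∀ s ∈ range T, ∀ t ∈ range T, uIcc s t ⊆ range T := fun s hs t ht =>
    hord.uIcc_subset hs ht
  have hint : ∀ s ∈ range T, ∀ t ∈ range T,
      IntervalIntegrable (fun u => forcedField a g (orbitCurve hg a p t₀ u)) volume s t := by
    intro s hs t ht
    have hc := hcont.mono (hsub s hs t ht)
    have hc1 : ContinuousOn (fun u => (orbitCurve hg a p t₀ u).1) (uIcc s t) :=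
      continuous_fst.comp_continuousOn hc
    have hc2 : ContinuousOn (fun u => (orbitCurve hg a p t₀ u).2) (uIcc s t) :=
      continuous_snd.comp_continuousOn hc
    have i2 := hc2.intervalIntegrable (μ := volume)
    have i3 : IntervalIntegrable (fun u => g |(orbitCurve hg a p t₀ u).1|) volume s t :=
      (hg.continuous.comp_continuousOn hc1.abs).intervalIntegrable
    rw [intervalIntegrable_iff] at i2 i3 ⊢
    refine Integrable.prodMk i2 ((i2.const_mul a).add ?_)
    -- The factor `Real.sign` may jump, but it is measurable and bounded by 1.
    refine Integrable.bdd_mul (c := 1) i3 ?_ ?_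
    · have := (hc1.mono uIoc_subset_uIcc).aemeasurable (μ := volume) measurableSet_uIoc
      exact (measurable_realSign.comp_aemeasurable this).aestronglyMeasurable
    · refine Eventually.of_forall fun u => ?_
      rcases Real.sign_apply_eq (orbitCurve hg a p t₀ u).1 with h | h | h <;> rw [h] <;> norm_num
  refine ⟨?_, hord, range_nonempty T, hcont, ?_, hint, ?_⟩
  · rw [isOpen_iff_mem_nhds]
    rintro _ ⟨s, rfl⟩
    exact range_mem_nhds hT hm s
  · rintro _ ⟨s, rfl⟩
    rw [orbitCurve_orbitTime hg a hp, Ne, forcedField_eq_zero_iff hg, straightening_apply]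
    intro h
    have h1 : (saddleFlow p s).1 = 0 := congrArg Prod.fst h
    have h2 : (saddleFlow p s).2 = 0 := (planeMap_eq_zero_iff hg a _ _).1 (congrArg Prod.snd h)
    exact saddleFlow_ne_zero hp s (Prod.ext h1 h2)
  · intro s hs t ht
    have hexc : {u | (saddleFlow p u).1 * (saddleFlow p u).2 = 0}.Subsingleton :=
      fun u hu v hv => (strictMono_saddleFlow_mul hp).injective (hu.trans hv.symm)
    refine (integral_eq_of_hasDerivAt_off_countable _ _
      (s := T '' {u | (saddleFlow p u).1 * (saddleFlow p u).2 = 0}) ?_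
      (hcont.mono (hsub s hs t ht)) ?_ (hint s hs t ht)).symm
    · exact (hexc.image T).countable
    · rintro u ⟨hu, hu'⟩
      obtain ⟨v, rfl⟩ := hsub s hs t ht (Ioo_subset_Icc_self hu)
      have hv : (saddleFlow p v).1 * (saddleFlow p v).2 ≠ 0 := fun h => hu' ⟨v, h, rfl⟩
      have hv1 := left_ne_zero_of_mul hv
      have hv2 := right_ne_zero_of_mul hv
      have hy := mt (planeMap_eq_zero_iff hg a (saddleFlow p v).1 _).1 hv2
      have hr : timeRatio a g (saddleFlow p v) =
          (saddleFlow p v).2 / planeMap a g (saddleFlow p v).1 (saddleFlow p v).2 := by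
        rw [timeRatio, if_neg hv2]
      have hi := hinv v
      have e1 : HasDerivAt (fun s => (saddleFlow p s).1) (saddleFlow p v).2
          (Function.invFun T (T v)) := by
        rw [hl]; exact hasDerivAt_saddleFlow_fst p v
      have e2 := hasDerivAt_planeMap_saddleFlow hg a p hv1 hv2
      rw [← hl v] at e2
      have d1 := e1.comp (T v) hi
      have d2 := e2.comp (T v) hi
      refine (d1.prodMk d2).congr_deriv ?_
      rw [orbitCurve_orbitTime hg a hp, straightening_apply, forcedField, hl, hr]
      refine Prod.ext ?_ ?_
      · simp only
        field_simp
      · simp only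
        field_simp

end PhasePortrait

/-! ### Arbitrary regular trajectories stay on one level. -/

namespace PhasePortrait

open Set MeasureTheory Filter Topology

variable {g : ℝ → ℝ} {a : ℝ}

theorem hasDerivAt_of_eventually_punctured {f : ℝ → ℝ} {c t₀ : ℝ}
    (h : ∀ᶠ t in 𝓝[≠] t₀, HasDerivAt f c t) (hf : ContinuousAt f t₀) : HasDerivAt f c t₀ := by
  have hr : 𝓝[>] t₀ ≤ 𝓝[≠] t₀ := nhdsWithin_mono _ fun x hx => ne_of_gt hx
  have hl : 𝓝[<] t₀ ≤ 𝓝[≠] t₀ := nhdsWithin_mono _ fun x hx => ne_of_lt hx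
  have hd : DifferentiableOn ℝ f {t | HasDerivAt f c t} := fun t ht =>
    (show HasDerivAt f c t from ht).differentiableAt.differentiableWithinAt
  have ht : Tendsto (fun x => deriv f x) (𝓝[≠] t₀) (𝓝 c) := by
    refine tendsto_const_nhds.congr' ?_
    filter_upwards [h] with t ht
    exact ht.deriv.symm
  have A := hasDerivWithinAt_Ici_of_tendsto_deriv hd hf.continuousWithinAt (hr h)
    (ht.mono_left hr)
  have B := hasDerivWithinAt_Iic_of_tendsto_deriv hd hf.continuousWithinAt (hl h)
    (ht.mono_left hl)
  simpa using B.union A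

/-- Axis crossings are isolated, and continuity restores the derivative at each of them. The case c
= 0 shows that the level is constant, the case c = 1 that the time changes match. -/
theorem sub_eq_mul_sub_of_deriv_off_discrete {I : Set ℝ} (hI : IsOpen I) (hI' : I.OrdConnected)
    {f : ℝ → ℝ} {c : ℝ} (hf : ContinuousOn f I)
    (h : ∀ t₀ ∈ I, ∀ᶠ t in 𝓝[≠] t₀, HasDerivAt f c t) {s t : ℝ} (hs : s ∈ I) (ht : t ∈ I) :
    f t - f s = c * (t - s) := by
  have hd : ∀ t ∈ I, HasDerivAt (fun t => f t - c * t) 0 t := fun t ht => by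
    have h1 := hasDerivAt_of_eventually_punctured (h t ht) (hf.continuousAt (hI.mem_nhds ht))
    have h2 := h1.sub ((hasDerivAt_id t).const_mul c)
    refine h2.congr_deriv ?_
    ring
  have := hI.is_const_of_deriv_eq_zero hI'.isPreconnected
    (fun t ht => (hd t ht).differentiableAt.differentiableWithinAt)
    (fun t ht => (hd t ht).deriv) ht hs
  linarith

theorem hasDerivAt_of_sub_eq_integral {E : Type*} [NormedAddCommGroup E] [NormedSpace ℝ E]
    [CompleteSpace E] {I V : Set ℝ} {u v : ℝ → E}
    (hint : ∀ s ∈ I, ∀ t ∈ I, IntervalIntegrable v volume s t)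
    (h : ∀ s ∈ I, ∀ t ∈ I, u t - u s = ∫ w in s..t, v w) (hV : IsOpen V) (hVI : V ⊆ I)
    (hv : ContinuousOn v V) {t : ℝ} (ht : t ∈ V) : HasDerivAt u (v t) t := by
  have h1 := intervalIntegral.integral_hasDerivAt_right (hint t (hVI ht) t (hVI ht))
    (hv.stronglyMeasurableAtFilter hV t ht) (hv.continuousAt (hV.mem_nhds ht))
  refine (h1.const_add (u t)).congr_of_eventuallyEq ?_
  filter_upwards [hV.mem_nhds ht] with s hs
  rw [← h t (hVI ht) s (hVI hs)]
  abel

section Trajectory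

variable {I : Set ℝ} {γ : ℝ → Plane}

theorem IsRegularTrajectory.hasDerivAt_fst (hγ : IsRegularTrajectory (forcedField a g) I γ)
    {t : ℝ} (ht : t ∈ I) : HasDerivAt (fun t => (γ t).1) (γ t).2 t := by
  have hc2 : ContinuousOn (fun u => (γ u).2) I := continuous_snd.comp_continuousOn hγ.continuousOn
  refine hasDerivAt_of_sub_eq_integral (v := fun t => (γ t).2) (fun s hs t ht => ?_)
    (fun s hs t ht => ?_) hγ.isOpen subset_rfl hc2 ht
  · exact (hc2.mono (hγ.ordConnected.uIcc_subset hs ht)).intervalIntegrable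
  · have h1 := congrArg Prod.fst (hγ.integral_eq s hs t ht)
    have h2 := (ContinuousLinearMap.fst ℝ ℝ ℝ).intervalIntegral_comp_comm (hγ.integrable s hs t ht)
    exact h1.trans h2.symm

/-- The condition x ≠ 0 is needed because sign(x) g(|x|) jumps at x = 0 when g(0) > 0. -/
theorem IsRegularTrajectory.hasDerivAt_snd (hg : IsForce g)
    (hγ : IsRegularTrajectory (forcedField a g) I γ) {t : ℝ} (ht : t ∈ I) (hx : (γ t).1 ≠ 0) :
    HasDerivAt (fun t => (γ t).2) (a * (γ t).2 + Real.sign (γ t).1 * g |(γ t).1|) t := by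
  have hc1 : ContinuousOn (fun u => (γ u).1) I := continuous_fst.comp_continuousOn hγ.continuousOn
  have hc2 : ContinuousOn (fun u => (γ u).2) I := continuous_snd.comp_continuousOn hγ.continuousOn
  have hV : IsOpen (I ∩ (fun u => (γ u).1) ⁻¹' {0}ᶜ) :=
    hc1.isOpen_inter_preimage hγ.isOpen isOpen_compl_singleton
  have := hasDerivAt_of_sub_eq_integral (u := fun t => (γ t).2)
    (v := fun t => (forcedField a g (γ t)).2) (fun s hs t ht => ?_)
    (fun s hs t ht => ?_) hV inter_subset_left ?_ ⟨ht, hx⟩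
  · exact this
  · have := hγ.integrable s hs t ht
    rw [intervalIntegrable_iff] at this ⊢
    exact this.snd
  · have h1 := congrArg Prod.snd (hγ.integral_eq s hs t ht)
    have h2 := (ContinuousLinearMap.snd ℝ ℝ ℝ).intervalIntegral_comp_comm (hγ.integrable s hs t ht)
    exact h1.trans h2.symm
  · rintro u ⟨hu, hu0⟩
    obtain ⟨σ, hσ, hσu⟩ := exists_unit_mul_pos hu0
    have c1 := hc1.continuousAt (hγ.isOpen.mem_nhds hu)
    have c2 := hc2.continuousAt (hγ.isOpen.mem_nhds hu)
    have c3 : ContinuousAt (fun u => a * (γ u).2 + σ * g |(γ u).1|) u :=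
      (c2.const_mul a).add ((hg.continuous.continuousAt.comp c1.abs).const_mul σ)
    refine (c3.congr ?_).continuousWithinAt
    filter_upwards [(c1.const_mul σ).eventually_const_lt hσu] with w hw
    rw [forcedField, sign_eq_unit hσ hw]

/-- The trajectory crosses the axes at isolated times. -/
theorem IsRegularTrajectory.eventually_ne_zero (hg : IsForce g)
    (hγ : IsRegularTrajectory (forcedField a g) I γ) {t : ℝ} (ht : t ∈ I) :
    ∀ᶠ u in 𝓝[≠] t, (γ u).1 ≠ 0 ∧ (γ u).2 ≠ 0 := by
  have c1 := (continuous_fst.comp_continuousOn hγ.continuousOn).continuousAt (hγ.isOpen.mem_nhds ht)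
  have c2 := (continuous_snd.comp_continuousOn hγ.continuousOn).continuousAt (hγ.isOpen.mem_nhds ht)
  refine Eventually.and ?_ ?_
  · by_cases hx : (γ t).1 = 0
    · refine (hγ.hasDerivAt_fst ht).eventually_ne fun hy => ?_
      exact hγ.regular t ht ((forcedField_eq_zero_iff hg).2 (Prod.ext hx hy))
    · exact (c1.eventually_ne hx).filter_mono nhdsWithin_le_nhds
  · by_cases hy : (γ t).2 = 0
    · have hx : (γ t).1 ≠ 0 := fun hx =>
        hγ.regular t ht ((forcedField_eq_zero_iff hg).2 (Prod.ext hx hy))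
      refine (hγ.hasDerivAt_snd hg ht hx).eventually_ne ?_
      rw [hy, mul_zero, zero_add]
      exact mul_ne_zero (mt Real.sign_eq_zero_iff.1 hx) (hg.pos _ (abs_pos.2 hx)).ne'
    · exact (c2.eventually_ne hy).filter_mono nhdsWithin_le_nhds

theorem planeMap_symm_straightening (hg : IsForce g) (a : ℝ) (p : Plane) :
    planeMap a g p.1 ((straightening hg a).symm p).2 = p.2 :=
  congrArg Prod.snd ((straightening hg a).apply_symm_apply p)

/-- Away from the axes, a trajectory stays locally on one profile. -/
theorem IsRegularTrajectory.eventually_level_eq (hg : IsForce g)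
    (hγ : IsRegularTrajectory (forcedField a g) I γ) {t₀ : ℝ} (ht₀ : t₀ ∈ I)
    (hx : (γ t₀).1 ≠ 0) (hy : (γ t₀).2 ≠ 0) :
    ∀ᶠ t in 𝓝 t₀, ((straightening hg a).symm (γ t)).2 ^ 2 - (γ t).1 ^ 2 =
      ((straightening hg a).symm (γ t₀)).2 ^ 2 - (γ t₀).1 ^ 2 := by
  set η := fun t => ((straightening hg a).symm (γ t)).2 with hη
  have hpη : ∀ t, planeMap a g (γ t).1 (η t) = (γ t).2 := fun t =>
    planeMap_symm_straightening hg a (γ t)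
  have hη0 : η t₀ ≠ 0 := fun h => hy (by rw [← hpη, h, planeMap_zero_right hg])
  obtain ⟨σ, hσ, hσx⟩ := exists_unit_mul_pos hx
  obtain ⟨ε, hε, hεη⟩ := exists_unit_mul_pos hη0
  set k := η t₀ ^ 2 - (γ t₀).1 ^ 2 with hk
  have c1 : ContinuousAt (fun t => (γ t).1) t₀ := (hγ.hasDerivAt_fst ht₀).continuousAt
  have c2 : ContinuousAt (fun t => (γ t).2) t₀ := (hγ.hasDerivAt_snd hg ht₀ hx).continuousAt
  have hkx : √(-k) < σ * (γ t₀).1 := by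
    rw [Real.sqrt_lt' hσx, ← abs_eq_unit_mul hσ hσx, sq_abs]
    have : 0 < η t₀ ^ 2 := by positivity
    linarith
  have hS := (levelProfile_spec hg (σ * ε * a) k).1
  set z := fun t => ε * levelProfile (σ * ε * a) g k (σ * (γ t).1) with hz
  have ε0 : ε ≠ 0 := by rcases hε with rfl | rfl <;> norm_num
  have hz0 : z t₀ = (γ t₀).2 := by
    rw [← hpη, planeMap_eq hg a hσ hε hσx.le hεη.le]
  have hzne : ∀ t, √(-k) < σ * (γ t).1 → z t ≠ 0 := fun t ht =>
    mul_ne_zero ε0 (hS.pos _ ht).ne'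
  have hev1 : ∀ᶠ t in 𝓝 t₀, √(-k) < σ * (γ t).1 := (c1.const_mul σ).eventually_const_lt hkx
  have cz : ContinuousAt z t₀ :=
    (hasDerivAt_branch hg a hσ hε (hγ.hasDerivAt_fst ht₀) hkx).continuousAt
  have cq : ContinuousAt (fun t => σ * g (σ * (γ t).1) / z t) t₀ :=
    ((hg.continuous.continuousAt.comp (c1.const_mul σ)).const_mul σ).div cz (hzne t₀ hkx)
  -- With z the height of the profile over the moving abscissa, the difference D = y - z solves the
  -- linear equation D' = -(σg/z) D with D(t₀) = 0, hence vanishes near t₀.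
  have hD : (fun t => (γ t).2 - z t) =ᶠ[𝓝 t₀] fun _ => 0 := by
    refine ODE_solution_unique_of_eventually
      (v := fun t w => -(σ * g (σ * (γ t).1) / z t) * w) (s := fun _ => univ)
      (K := Real.toNNReal (|σ * g (σ * (γ t₀).1) / z t₀| + 1)) ?_ ?_ ?_ ?_
    · filter_upwards [cq.abs.eventually_lt_const (lt_add_one _)] with t ht
      refine LipschitzOnWith.of_dist_le_mul fun u _ w _ => ?_
      rw [Real.coe_toNNReal _ (by positivity), Real.dist_eq, Real.dist_eq, ← mul_sub, abs_mul,
        abs_neg]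
      gcongr
    · filter_upwards [hev1, hγ.isOpen.mem_nhds ht₀] with t ht htI
      have hσt : 0 < σ * (γ t).1 := (Real.sqrt_nonneg _).trans_lt ht
      have hxt : (γ t).1 ≠ 0 := fun h => by simp [h] at hσt
      have h1 := hγ.hasDerivAt_snd hg htI hxt
      have h2 := hasDerivAt_branch hg a hσ hε (hγ.hasDerivAt_fst htI) ht
      refine ⟨(h1.sub h2).congr_deriv ?_, mem_univ _⟩
      rw [sign_eq_unit hσ hσt, abs_eq_unit_mul hσ hσt]
      have h3 := hzne t ht
      change a * (γ t).2 + σ * g (σ * (γ t).1) - (γ t).2 * (a + σ * g (σ * (γ t).1) / z t) = _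
      field_simp
      ring
    · refine Eventually.of_forall fun t => ⟨?_, mem_univ _⟩
      simpa using hasDerivAt_const t (0 : ℝ)
    · simp [hz0]
  have hkpos : 0 < k + (γ t₀).1 ^ 2 := by
    have : 0 < η t₀ ^ 2 := by positivity
    linarith
  filter_upwards [hev1, hD, ((c1.pow 2).const_add k).eventually_const_lt hkpos] with t h1 h2 h3
  have hσt : 0 < σ * (γ t).1 := (Real.sqrt_nonneg _).trans_lt h1
  have h3 : 0 ≤ k + (γ t).1 ^ 2 := le_of_lt h3
  have e2 : ε * ε = 1 := by rcases hε with rfl | rfl <;> norm_num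
  have e3 : (ε * √(k + (γ t).1 ^ 2)) ^ 2 = k + (γ t).1 ^ 2 := by
    rw [mul_pow, sq ε, e2, one_mul, Real.sq_sqrt h3]
  -- The point of the hyperbola of level k over the same abscissa is sent to γ t, so by injectivity
  -- it has ordinate η t.
  have h4 : planeMap a g (γ t).1 (ε * √(k + (γ t).1 ^ 2)) = (γ t).2 := by
    rw [planeMap_eq hg a hσ hε hσt.le
      (by rw [← mul_assoc, e2, one_mul]; exact Real.sqrt_nonneg _), e3, add_sub_cancel_right]
    exact (sub_eq_zero.1 h2).symm
  have h5 : η t = ε * √(k + (γ t).1 ^ 2) :=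
    (strictMono_planeMap hg a (γ t).1).injective ((hpη t).trans h4.symm)
  change η t ^ 2 - (γ t).1 ^ 2 = k
  rw [h5, e3]
  ring

theorem IsRegularTrajectory.level_eq (hg : IsForce g)
    (hγ : IsRegularTrajectory (forcedField a g) I γ) {s t : ℝ} (hs : s ∈ I) (ht : t ∈ I) :
    ((straightening hg a).symm (γ t)).2 ^ 2 - ((straightening hg a).symm (γ t)).1 ^ 2 =
      ((straightening hg a).symm (γ s)).2 ^ 2 - ((straightening hg a).symm (γ s)).1 ^ 2 := by
  have hc : ContinuousOn (fun t => (straightening hg a).symm (γ t)) I :=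
    (straightening hg a).symm.continuous.comp_continuousOn hγ.continuousOn
  have := sub_eq_mul_sub_of_deriv_off_discrete hγ.isOpen hγ.ordConnected (c := 0)
    (((continuous_snd.comp_continuousOn hc).pow 2).sub ((continuous_fst.comp_continuousOn hc).pow 2))
    (fun t₀ ht₀ => ?_) hs ht
  · rw [zero_mul] at this
    exact sub_eq_zero.1 this
  · filter_upwards [hγ.eventually_ne_zero hg ht₀,
      nhdsWithin_le_nhds (hγ.isOpen.mem_nhds ht₀)] with u hu huI
    have h := hγ.eventually_level_eq hg huI hu.1 hu.2
    exact (hasDerivAt_const u _).congr_of_eventuallyEq h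

end Trajectory

/-! ### Lifting a trajectory to the time of the saddle. -/

/-- A path in a level set of `η² - x²` that avoids the origin is a path along one orbit of the
linear saddle; case of orbits off the stable separatrices. -/
theorem exists_saddleFlow_lift_of_ne {I : Set ℝ} (hI : I.OrdConnected) {q : ℝ → Plane}
    (hq : ContinuousOn q I) (hq0 : ∀ t ∈ I, q t ≠ 0) {t₀ : ℝ} (ht₀ : t₀ ∈ I)
    (hlevel : ∀ t ∈ I, (q t).2 ^ 2 - (q t).1 ^ 2 = (q t₀).2 ^ 2 - (q t₀).1 ^ 2)
    (hu : (q t₀).1 + (q t₀).2 ≠ 0) :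
    ∃ s : ℝ → ℝ, ContinuousOn s I ∧ s t₀ = 0 ∧ ∀ t ∈ I, q t = saddleFlow (q t₀) (s t) := by
  have c1 : ContinuousOn (fun t => (q t).1) I := continuous_fst.comp_continuousOn hq
  have c2 : ContinuousOn (fun t => (q t).2) I := continuous_snd.comp_continuousOn hq
  have hprod : ∀ t ∈ I, ((q t).1 + (q t).2) * ((q t).1 - (q t).2) =
      ((q t₀).1 + (q t₀).2) * ((q t₀).1 - (q t₀).2) := fun t ht => by
    linear_combination -hlevel t ht
  have hboth : ∀ t ∈ I, ¬ ((q t).1 + (q t).2 = 0 ∧ (q t).1 - (q t).2 = 0) := fun t ht h =>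
    hq0 t ht (Prod.ext (by simp only [Prod.fst_zero]; linarith [h.1, h.2])
      (by simp only [Prod.snd_zero]; linarith [h.1, h.2]))
  have hivt : ∀ f : ℝ → ℝ, ContinuousOn f I → ∀ t ∈ I, 0 < f t₀ → f t < 0 → ∃ z ∈ I, f z = 0 := by
    intro f hf t ht h0 h1
    have := hI.isPreconnected.intermediate_value ht ht₀ hf ⟨h1.le, h0.le⟩
    exact this
  -- Put u = x + η and w = x - η. If u vanished somewhere, the constant uw would be 0 and w(t₀) = 0.
  -- Then |u| - |w| would change sign, and at its zero uw = 0 would force u = w = 0, the excluded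
  -- origin.
  have hne : ∀ t ∈ I, (q t).1 + (q t).2 ≠ 0 := by
    intro t ht h
    have hz : ∀ z ∈ I, ((q z).1 + (q z).2) * ((q z).1 - (q z).2) = 0 := fun z hz => by
      rw [hprod z hz, ← hprod t ht, h, zero_mul]
    have h0 : (q t₀).1 - (q t₀).2 = 0 := (mul_eq_zero.1 (hz t₀ ht₀)).resolve_left hu
    obtain ⟨z, hzI, hz0⟩ := hivt (fun t => |(q t).1 + (q t).2| - |(q t).1 - (q t).2|)
      ((c1.add c2).abs.sub (c1.sub c2).abs) t ht
      (by simpa [h0] using hu) (by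
        have : (q t).1 - (q t).2 ≠ 0 := fun h' => hboth t ht ⟨h, h'⟩
        simpa [h] using this)
    have h2 := hz z hzI
    simp only [sub_eq_zero] at hz0
    rcases mul_eq_zero.1 h2 with h3 | h3
    · rw [h3, abs_zero] at hz0
      exact hboth z hzI ⟨h3, abs_eq_zero.1 hz0.symm⟩
    · rw [h3, abs_zero] at hz0
      exact hboth z hzI ⟨abs_eq_zero.1 hz0, h3⟩
  have hpos : ∀ t ∈ I, 0 < ((q t).1 + (q t).2) / ((q t₀).1 + (q t₀).2) := by
    intro t ht
    by_contra! hle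
    have hlt := lt_of_le_of_ne hle (div_ne_zero (hne t ht) hu)
    obtain ⟨z, hzI, hz0⟩ := hivt (fun t => ((q t).1 + (q t).2) / ((q t₀).1 + (q t₀).2))
      ((c1.add c2).div_const _) t ht (by simp [div_self hu]) hlt
    exact div_ne_zero (hne z hzI) hu hz0
  -- In the coordinates u and w the flow is (u e^s, w e^(-s)), so s is the logarithm of the growth
  -- of u.
  refine ⟨fun t => Real.log (((q t).1 + (q t).2) / ((q t₀).1 + (q t₀).2)), ?_, ?_, ?_⟩
  · exact ((c1.add c2).div_const _).log fun t ht => (hpos t ht).ne'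
  · simp [div_self hu]
  · intro t ht
    have e1 := Real.exp_log (hpos t ht)
    have e2 : Real.exp (-Real.log (((q t).1 + (q t).2) / ((q t₀).1 + (q t₀).2))) =
        ((q t₀).1 + (q t₀).2) / ((q t).1 + (q t).2) := by
      rw [Real.exp_neg, e1, inv_div]
    have hp := hprod t ht
    have hn := hne t ht
    have f1 : ((q t₀).1 + (q t₀).2) * Real.exp (Real.log (((q t).1 + (q t).2) /
        ((q t₀).1 + (q t₀).2))) = (q t).1 + (q t).2 := by
      rw [e1]
      field_simp
    have f2 : ((q t₀).1 - (q t₀).2) * Real.exp (-Real.log (((q t).1 + (q t).2) /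
        ((q t₀).1 + (q t₀).2))) = (q t).1 - (q t).2 := by
      rw [e2, ← mul_div_assoc, div_eq_iff hn]
      linarith
    rw [saddleFlow, Real.cosh_eq, Real.sinh_eq]
    refine Prod.ext ?_ ?_
    · simp only
      linear_combination -(f1 + f2) / 2
    · simp only
      linear_combination -(f1 - f2) / 2

theorem exists_saddleFlow_lift {I : Set ℝ} (hI : I.OrdConnected) {q : ℝ → Plane}
    (hq : ContinuousOn q I) (hq0 : ∀ t ∈ I, q t ≠ 0) {t₀ : ℝ} (ht₀ : t₀ ∈ I)
    (hlevel : ∀ t ∈ I, (q t).2 ^ 2 - (q t).1 ^ 2 = (q t₀).2 ^ 2 - (q t₀).1 ^ 2) :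
    ∃ s : ℝ → ℝ, ContinuousOn s I ∧ s t₀ = 0 ∧ ∀ t ∈ I, q t = saddleFlow (q t₀) (s t) := by
  by_cases hu : (q t₀).1 + (q t₀).2 = 0
  · have hw : (q t₀).1 + -(q t₀).2 ≠ 0 := fun h =>
      hq0 t₀ ht₀ (Prod.ext (by simp only [Prod.fst_zero]; linarith)
        (by simp only [Prod.snd_zero]; linarith))
    -- On u = 0 the logarithm is unavailable. The reflection η ↦ -η exchanges u and w and reverses
    -- the saddle's time, whence -s below.
    obtain ⟨s, hs, hs0, h⟩ := exists_saddleFlow_lift_of_ne hI (q := fun t => ((q t).1, -(q t).2))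
      ((continuous_fst.comp_continuousOn hq).prodMk (continuous_snd.comp_continuousOn hq).neg)
      (fun t ht h => hq0 t ht (Prod.ext (Prod.ext_iff.1 h).1
        (neg_eq_zero.1 (Prod.ext_iff.1 h).2))) ht₀
      (fun t ht => by simpa using hlevel t ht) hw
    refine ⟨fun t => -s t, hs.neg, by simp [hs0], fun t ht => ?_⟩
    have h1 := congrArg Prod.fst (h t ht)
    have h2 := congrArg Prod.snd (h t ht)
    simp only [saddleFlow] at h1 h2
    rw [saddleFlow, Real.cosh_neg, Real.sinh_neg]
    refine Prod.ext ?_ ?_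
    · simp only
      linear_combination h1
    · simp only
      linear_combination -h2
  · exact exists_saddleFlow_lift_of_ne hI hq hq0 ht₀ hlevel hu

theorem hasStrictDerivAt_saddleFlow_fst (p : Plane) (s : ℝ) :
    HasStrictDerivAt (fun s => (saddleFlow p s).1) (saddleFlow p s).2 s :=
  ((Real.hasStrictDerivAt_cosh s).const_mul p.1).add ((Real.hasStrictDerivAt_sinh s).const_mul p.2)

/-- A regular trajectory is part of an orbit curve. -/
theorem IsRegularTrajectory.eqOn_orbitCurve (hg : IsForce g) {I : Set ℝ} {γ : ℝ → Plane}
    (hγ : IsRegularTrajectory (forcedField a g) I γ) {t₀ : ℝ} (ht₀ : t₀ ∈ I) :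
    ∀ t ∈ I, t ∈ range (orbitTime a g ((straightening hg a).symm (γ t₀)) t₀) ∧
      γ t = orbitCurve hg a ((straightening hg a).symm (γ t₀)) t₀ t := by
  have hc : ContinuousOn (fun t => (straightening hg a).symm (γ t)) I :=
    (straightening hg a).symm.continuous.comp_continuousOn hγ.continuousOn
  have hpη : ∀ t, planeMap a g (γ t).1 ((straightening hg a).symm (γ t)).2 = (γ t).2 := fun t =>
    planeMap_symm_straightening hg a (γ t)
  have hq0 : ∀ t ∈ I, (straightening hg a).symm (γ t) ≠ 0 := by
    intro t ht h
    refine hγ.regular t ht ((forcedField_eq_zero_iff hg).2 (Prod.ext ?_ ?_))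
    · exact (Prod.ext_iff.1 h).1
    · rw [← hpη t, h, Prod.snd_zero, planeMap_zero_right hg]
  obtain ⟨s, hs, hs0, hqs⟩ := exists_saddleFlow_lift hγ.ordConnected hc hq0 ht₀
    fun t ht => hγ.level_eq hg ht₀ ht
  set p := (straightening hg a).symm (γ t₀) with hp
  have hp0 : p ≠ 0 := hq0 t₀ ht₀
  have hT := hasDerivAt_orbitTime hg a hp0 t₀
  have hTc : Continuous (orbitTime a g p t₀) :=
    continuous_iff_continuousAt.2 fun u => (hT u).continuousAt
  -- Where η ≠ 0 the first component of the flow has a local inverse, so s is differentiable with s'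
  -- = y/η. The time ratio there is η/y, and the product is 1.
  have hder : ∀ t ∈ I, (γ t).2 ≠ 0 → HasDerivAt (fun t => orbitTime a g p t₀ (s t)) 1 t := by
    intro t ht hy
    have hfl : ∀ t ∈ I, (saddleFlow p (s t)).1 = (γ t).1 := fun t ht =>
      (congrArg Prod.fst (hqs t ht)).symm
    have hη : (saddleFlow p (s t)).2 ≠ 0 := by
      intro h
      apply hy
      rw [← hpη t, hqs t ht, h, planeMap_zero_right hg]
    have hst := hasStrictDerivAt_saddleFlow_fst p (s t)
    have hL := (hst.to_localInverse hη).hasDerivAt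
    have hcs : ContinuousAt s t := hs.continuousAt (hγ.isOpen.mem_nhds ht)
    have hleft : ∀ᶠ u in 𝓝 (s t), hst.localInverse _ _ _ hη (saddleFlow p u).1 = u :=
      HasStrictFDerivAt.eventually_left_inverse (hst.hasStrictFDerivAt_equiv hη)
    have hsd : HasDerivAt s ((saddleFlow p (s t)).2⁻¹ * (γ t).2) t := by
      rw [hfl t ht] at hL
      refine (hL.comp t (hγ.hasDerivAt_fst ht)).congr_of_eventuallyEq ?_
      filter_upwards [hcs.eventually hleft, hγ.isOpen.mem_nhds ht] with u hu huI
      rw [Function.comp_apply, ← hfl u huI, hu]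
    refine ((hT (s t)).comp t hsd).congr_deriv ?_
    have h1 : planeMap a g (saddleFlow p (s t)).1 (saddleFlow p (s t)).2 = (γ t).2 := by
      rw [← hpη t, hqs t ht, hfl t ht]
    rw [timeRatio, if_neg hη, h1]
    field_simp
  have hmain : ∀ t ∈ I, orbitTime a g p t₀ (s t) = t := by
    intro t ht
    have := sub_eq_mul_sub_of_deriv_off_discrete hγ.isOpen hγ.ordConnected
      (hTc.comp_continuousOn hs) (c := 1) (fun t₁ ht₁ => ?_) ht₀ ht
    · rw [Function.comp_apply, Function.comp_apply, hs0, orbitTime_zero] at this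
      linarith
    · filter_upwards [hγ.eventually_ne_zero hg ht₁,
        nhdsWithin_le_nhds (hγ.isOpen.mem_nhds ht₁)] with u hu huI
      exact hder u huI hu.2
  intro t ht
  refine ⟨⟨s t, hmain t ht⟩, ?_⟩
  conv_rhs => rw [← hmain t ht]
  rw [orbitCurve_orbitTime hg a hp0, ← hqs t ht]
  exact ((straightening hg a).apply_symm_apply (γ t)).symm

end PhasePortrait

/-! ### Matching maximal trajectories, and the power-law fields. -/

namespace PhasePortrait

open Set MeasureTheory Filter Topology

variable {g g' : ℝ → ℝ} {a a' : ℝ}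

/-- An extension is a regular trajectory through the same point at t₀, and all times of such a
trajectory lie in the range of the same `orbitTime`. -/
theorem isMaximalRegularTrajectory_orbitCurve (hg : IsForce g) (a : ℝ) {p : Plane} (hp : p ≠ 0)
    (t₀ : ℝ) : IsMaximalRegularTrajectory (forcedField a g) (range (orbitTime a g p t₀))
      (orbitCurve hg a p t₀) := by
  refine ⟨isRegularTrajectory_orbitCurve hg a hp t₀, fun J δ hδ hJ heq => ?_⟩
  have ht₀ : t₀ ∈ range (orbitTime a g p t₀) := ⟨0, orbitTime_zero a g p t₀⟩
  have h0 : δ t₀ = straightening hg a p := by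
    rw [← heq ht₀]
    have := orbitCurve_orbitTime hg a hp t₀ 0
    rwa [orbitTime_zero, saddleFlow_zero] at this
  refine Subset.antisymm (fun t ht => ?_) hJ
  have := (hδ.eqOn_orbitCurve hg (hJ ht₀) t ht).1
  rwa [h0, Homeomorph.symm_apply_apply] at this

theorem IsMaximalRegularTrajectory.exists_eq_orbitCurve (hg : IsForce g) {I : Set ℝ}
    {γ : ℝ → Plane} (hγ : IsMaximalRegularTrajectory (forcedField a g) I γ) :
    ∃ (p : Plane) (t₀ : ℝ), p ≠ 0 ∧ I = range (orbitTime a g p t₀) ∧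
      EqOn γ (orbitCurve hg a p t₀) I := by
  obtain ⟨t₀, ht₀⟩ := hγ.1.nonempty
  have h := hγ.1.eqOn_orbitCurve hg ht₀
  have hp : (straightening hg a).symm (γ t₀) ≠ 0 := by
    intro h0
    refine hγ.1.regular t₀ ht₀ ((forcedField_eq_zero_iff hg).2 (Prod.ext ?_ ?_))
    · exact (Prod.ext_iff.1 h0).1
    · rw [← planeMap_symm_straightening hg a, h0, Prod.snd_zero, planeMap_zero_right hg]
  refine ⟨_, t₀, hp, ?_, fun t ht => (h t ht).2⟩
  exact (hγ.2 _ _ (isRegularTrajectory_orbitCurve hg a hp t₀) (fun t ht => (h t ht).1)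
    fun t ht => (h t ht).2).symm

theorem straightening_zero (hg : IsForce g) (a : ℝ) : straightening hg a 0 = 0 := by
  rw [straightening_apply]
  exact Prod.ext rfl (planeMap_zero_right hg a _)

/-- Both orbits are images of one saddle orbit. The change of parameter passes through the saddle's
time and is increasing because both orbit times are. -/
theorem mapsOrbits_straightening (hg : IsForce g) (hg' : IsForce g') (a a' : ℝ) :
    MapsOrbits (fun p => straightening hg' a' ((straightening hg a).symm p)) (forcedField a g)
      (forcedField a' g') := by
  rintro I γ (⟨rfl, p, hp, hγ⟩ | hγ)
  · refine ⟨univ, fun _ => 0, id, Or.inl ⟨rfl, 0, (forcedField_eq_zero_iff hg').2 rfl,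
      fun _ => rfl⟩, strictMonoOn_id, image_id _, fun t _ => ?_⟩
    have h0 : (straightening hg a).symm 0 = 0 := by
      rw [Homeomorph.symm_apply_eq, straightening_zero]
    simp only
    rw [hγ t, (forcedField_eq_zero_iff hg).1 hp, h0, straightening_zero]
  · obtain ⟨p, t₀, hp, rfl, heq⟩ := hγ.exists_eq_orbitCurve hg
    have hm := strictMono_orbitTime hg a hp t₀
    have hm' := strictMono_orbitTime hg' a' hp t₀
    have hl : ∀ s, Function.invFun (orbitTime a g p t₀) (orbitTime a g p t₀ s) = s :=
      Function.leftInverse_invFun hm.injective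
    refine ⟨range (orbitTime a' g' p t₀), orbitCurve hg' a' p t₀,
      fun t => orbitTime a' g' p t₀ (Function.invFun (orbitTime a g p t₀) t),
      Or.inr (isMaximalRegularTrajectory_orbitCurve hg' a' hp t₀), ?_, ?_, ?_⟩
    · rintro _ ⟨u, rfl⟩ _ ⟨v, rfl⟩ h
      simp only [hl]
      exact hm' (hm.lt_iff_lt.1 h)
    · rw [← range_comp]
      congr 1
      funext s
      simp only [Function.comp_apply, hl]
    · rintro _ ⟨s, rfl⟩
      simp only
      rw [heq ⟨s, rfl⟩, orbitCurve_orbitTime hg a hp, Homeomorph.symm_apply_apply, hl,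
        orbitCurve_orbitTime hg' a' hp]

theorem topologicallyEquivalent_forcedField (hg : IsForce g) (hg' : IsForce g') (a a' : ℝ) :
    TopologicallyEquivalent (forcedField a g) (forcedField a' g') :=
  ⟨(straightening hg a).symm.trans (straightening hg' a'),
    mapsOrbits_straightening hg hg' a a', mapsOrbits_straightening hg' hg a' a⟩

/-- At α = 0 the convention 0^0 = 1 makes the force the constant 1/Λ, continuous at 0; the jump of
the field is carried by the sign alone. -/
theorem isForce_rpow {α Λ : ℝ} (hα : 0 ≤ α) (hΛ : 0 < Λ) : IsForce fun x => |x| ^ α / Λ where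
  continuous := ((Real.continuous_rpow_const hα).comp continuous_abs).div_const Λ
  nonneg x := by positivity
  pos x hx := by positivity
  mono x hx y hy hxy := by
    have hx : 0 ≤ x := hx
    have hy : 0 ≤ y := hy
    simp only [abs_of_nonneg hx, abs_of_nonneg hy]
    gcongr

theorem extendedField_eq_forcedField (c α Λ : ℝ) :
    extendedField c α Λ = forcedField (c / Λ) fun x => |x| ^ α / Λ := by
  funext p
  refine Prod.ext rfl ?_
  simp only [extendedField, forcedField, abs_abs]
  ring

theorem topologicallyEquivalent_extendedField {α Λ α' Λ' : ℝ} (c c' : ℝ) (hα : 0 ≤ α)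
    (hΛ : 0 < Λ) (hα' : 0 ≤ α') (hΛ' : 0 < Λ') :
    TopologicallyEquivalent (extendedField c α Λ) (extendedField c' α' Λ') := by
  rw [extendedField_eq_forcedField, extendedField_eq_forcedField]
  exact topologicallyEquivalent_forcedField (isForce_rpow hα hΛ) (isForce_rpow hα' hΛ') _ _

theorem extendedField_zero_one_one : extendedField 0 1 1 = linearSaddle := by
  funext p
  refine Prod.ext rfl ?_
  simp only [extendedField, linearSaddle, Real.rpow_one]
  rcases lt_trichotomy p.1 0 with h | h | h
  · rw [Real.sign_of_neg h, abs_of_neg h]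
    ring
  · simp [h]
  · rw [Real.sign_of_pos h, abs_of_pos h]
    ring

/-- On the positive x-axis the second component has difference quotients x^(α-1)/Λ at 0, which tend
to infinity as x tends to 0. -/
theorem not_differentiableAt_extendedField {α Λ : ℝ} (c : ℝ) (hα : α < 1) (hΛ : 0 < Λ) :
    ¬ DifferentiableAt ℝ (extendedField c α Λ) (0, 0) := by
  intro h
  have h1 : DifferentiableAt ℝ (fun x : ℝ => (extendedField c α Λ (x, 0)).2) 0 :=
    (h.comp (f := fun x : ℝ => ((x, 0) : Plane)) (0 : ℝ)
      (differentiableAt_id.prodMk (differentiableAt_const (0 : ℝ)))).snd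
  have h2 := (hasDerivAt_iff_tendsto_slope.1 h1.hasDerivAt).mono_left
    (nhdsWithin_mono (0 : ℝ) (fun x (hx : x ∈ Ioi 0) => ne_of_gt hx))
  have h3 : Tendsto (fun x : ℝ => (1 / Λ) * x ^ (α - 1)) (𝓝[>] 0) atTop :=
    (tendsto_rpow_neg_nhdsGT_zero (by linarith)).const_mul_atTop (by positivity)
  refine not_tendsto_nhds_of_tendsto_atTop h3 _ (h2.congr' ?_)
  filter_upwards [self_mem_nhdsWithin] with x hx
  have hx : 0 < x := hx
  rw [Real.rpow_sub_one hx.ne']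
  simp [slope, extendedField, Real.sign_of_pos hx, abs_of_pos hx]
  ring

end PhasePortrait

theorem proposition4p2 :
    (∀ c α Λ : ℝ, 0 ≤ c → 0 ≤ α → α ≤ 1 → 0 < Λ →
      PhasePortrait.TopologicallyEquivalent
        (PhasePortrait.extendedField c α Λ) PhasePortrait.linearSaddle) ∧
    (∀ c α Λ c' α' Λ' : ℝ, 0 ≤ c → 0 ≤ α → α ≤ 1 → 0 < Λ → 0 ≤ c' → 0 ≤ α' → α' ≤ 1 → 0 < Λ' →
      PhasePortrait.phasePortrait (PhasePortrait.extendedField c α Λ) =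
        PhasePortrait.phasePortrait (PhasePortrait.extendedField c' α' Λ')) ∧
    PhasePortrait.extendedField 0 1 1 = PhasePortrait.linearSaddle ∧
    (∀ c α Λ : ℝ, 0 ≤ c → 0 ≤ α → α < 1 → 0 < Λ →
      ¬ ContDiff ℝ 1 (PhasePortrait.extendedField c α Λ) ∧
      ¬ PhasePortrait.IsHyperbolicSingularity (PhasePortrait.extendedField c α Λ) (0, 0)) := by
  refine ⟨fun c α Λ _ hα _ hΛ => ?_, fun c α Λ c' α' Λ' _ hα _ hΛ _ hα' _ hΛ' => ?_,
    PhasePortrait.extendedField_zero_one_one, fun c α Λ _ _ hα hΛ => ⟨fun h => ?_, ?_⟩⟩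
  · rw [← PhasePortrait.extendedField_zero_one_one]
    exact PhasePortrait.topologicallyEquivalent_extendedField c 0 hα hΛ zero_le_one one_pos
  · exact Quotient.sound
      (PhasePortrait.topologicallyEquivalent_extendedField c c' hα hΛ hα' hΛ')
  · exact PhasePortrait.not_differentiableAt_extendedField c hα hΛ
      (h.differentiable one_ne_zero).differentiableAt
  · rintro ⟨-, A, hA, -⟩
    exact PhasePortrait.not_differentiableAt_extendedField c hα hΛ hA.differentiableAt
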